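/- Let $\mathbb{F}_q$ be a finite field with $q$ elements, $A=\mathbb{F}_q[\theta]$, and let $A_+\subset A$ be the set of monic polynomials. Let $\phi$ be a Drinfeld $A$-module over $A$ of rank $r\ge 1$, given by $\phi_\theta=\sum_{i=0}^r\phi_{\theta,i}\tau^i$ with $\phi_{\theta,i}\in A$, $\phi_{\theta,0}=\theta$, $\phi_{\theta,r}\neq 0$. *The function $\mu$.* Let $f\in A_+$ be irreducible of degree $d$, and let $\overline{\phi}$ be the reduction of $\phi$ modulo $f$, acting on an algebraic closure of $A/fA$ with $\tau(x)=x^q$. For $h\in A_+$ irreducible, $h\ne f$, let $T_h(\overline{\phi})=\varprojlim_k\overline{\phi}[h^k]$ be the Tate module, which is free of finite rank $r_0$ over the $h$-adic completion of $A$. The characteristic polynomial of $\tau^d$ on $T_h(\overline{\phi})$ is a polynomial $P_f(x)=x^{r_0}+p_{r_0-1}x^{r_0-1}+\dots+p_0\in A[x]$ independent of $h$, and, if $r_0\geq 1$, $p_0=c(f)^{-1}f$ with $c(f)\in\mathbb{F}_q^\times$. Put $D_f(x)=1+\sum_{i=1}^{r_0}c(f)\,p_i\,f^{i-1}x^i$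 (so $D_f=1$ if $r_0=0$). Then $\mu\colon A_+\to A$ is the multiplicative function with $\sum_{i\ge0}\mu(f^i)x^i=D_f(x)^{-1}$ in $A[[x]]$ for every irreducible $f\in A_+$. *The module $\psi$.* Let $n\ge 0$, let $z_1,\dots,z_n,t$ be indeterminates, $k=\mathbb{F}_q(z_1,\dots,z_n,t)$ and $\tilde{\mathbb{A}}=k[\theta]$, and let $\tau$ be the $k$-algebra endomorphism of $\tilde{\mathbb{A}}$ with $\tau(\theta)=\theta^q$. For $i\ge0$ put $\ell_i(z)=\prod_{j=0}^{i-1}(z-\theta^{q^j})$. Let $\psi$ be the Drinfeld $\tilde{\mathbb{A}}$-module with $$\psi_\theta=\sum_{i=0}^r t^i\ell_i(z_1)\cdots\ell_i(z_n)\phi_{\theta,i}\tau^i .$$ For $f\in A_+$ irreducible, let $\psi(\tilde{\mathbb{A}}/f\tilde{\mathbb{A}})$ be $\tilde{\mathbb{A}}/f\tilde{\mathbb{A}}$ with $\theta$ acting through $\psi_\theta$. For a $k[\theta]$-module $M$ of finite dimension over $k$, let $[M]_{\tilde{\mathbb{A}}}\in k[\theta]$ be the monic generator of its Fitting ideal,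 that is, the characteristic polynomial of the action of $\theta$ on $M$ evaluated at $\theta$. Then the infinite product defining the Taelman $L$-value of $\psi$ and the series below converge (unconditionally) in $k((\theta^{-1}))$, and $$L(\psi,\tilde{\mathbb{A}}):=\prod_{f\in A_+\text{ irreducible}}\frac{[\tilde{\mathbb{A}}/f\tilde{\mathbb{A}}]_{\tilde{\mathbb{A}}}}{[\psi(\tilde{\mathbb{A}}/f\tilde{\mathbb{A}})]_{\tilde{\mathbb{A}}}}=\sum_{a\in A_+}\frac{\mu(a)\,a(z_1)\cdots a(z_n)\,t^{\deg_\theta a}}{a}.$$ -/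

import Mathlib

open Polynomial

noncomputable section

namespace TaelmanL

/-! Throughout, `F` is the finite field `𝔽_q`, `q = Fintype.card F`, the ring `A = 𝔽_q[θ]` is
`F[X]` with `X` in the role of `θ`, and likewise `k[θ]` is `k[X]` for every field `k`. -/

section Basic

variable (F : Type*) [Field F]

/-- The set `A₊` of monic polynomials. -/
abbrev MonicPoly := {a : F[X] // a.Monic}

/-- The irreducible elements of `A₊`. -/
abbrev MonicIrred := {f : F[X] // f.Monic ∧ Irreducible f}

instance (f : MonicIrred F) : Fact (Irreducible f.1) := ⟨f.2.2⟩

/-- A Drinfeld `A`-module over `A`, given by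
`φ_θ = θ + φ_{θ,1} τ + ⋯ + φ_{θ,r} τ ^ r` with `φ_{θ,r} ≠ 0`. As `A` is freely generated by `θ` as
an `𝔽_q`-algebra, `φ_θ` determines the homomorphism `φ : A → A{τ}`. -/
structure DrinfeldModule where
  /-- the rank `r` -/
  rank : ℕ
  /-- the coefficients `φ_{θ,i}` -/
  coeff : ℕ → F[X]
  rank_pos : 0 < rank
  coeff_zero : coeff 0 = X
  coeff_rank : coeff rank ≠ 0
  coeff_of_gt : ∀ i, rank < i → coeff i = 0

end Basic

/-- The action on `R` of the skew polynomial `c₀ + c₁ τ + ⋯ + c_r τ ^ r ∈ R{τ}`. -/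
def skewOp {k R : Type*} [CommRing k] [CommRing R] [Algebra k R] (τ : R →ₐ[k] R) (r : ℕ)
    (c : ℕ → R) : Module.End k R :=
  ∑ i ∈ Finset.range (r + 1), LinearMap.mulLeft k (c i) * τ.toLinearMap ^ i

/-- The monic generator `[M]_{k[θ]}` of the Fitting ideal of a `k[θ]`-module `M` of finite dimension
over the field `k`: the characteristic polynomial of the action of `θ`, evaluated at `θ`. -/
def fittingGen (k M : Type*) [Field k] [AddCommGroup M] [Module k M] [Module k[X] M]
    [IsScalarTower k k[X] M] [Module.Finite k M] : k[X] :=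
  (Algebra.lsmul k k M (X : k[X])).charpoly

/-! ### Tate modules -/

section Tate

variable {R : Type*} [CommRing R] (N : Type*) [AddCommGroup N] [Module R N] (h : R)

/-- The `h`-adic Tate module `lim N[h ^ k]` of an `R`-module `N`, the transition maps
`N[h ^ (k + 1)] → N[h ^ k]` being multiplication by `h`. -/
def tateModule : Submodule R (ℕ → N) where
  carrier := {x | x 0 = 0 ∧ ∀ k, h • x (k + 1) = x k}
  add_mem' := by
    rintro x y ⟨hx, hx'⟩ ⟨hy, hy'⟩
    exact ⟨by simp [hx, hy], fun k => by simp [smul_add, hx', hy']⟩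
  zero_mem' := by simp
  smul_mem' := by
    rintro a x ⟨hx, hx'⟩
    exact ⟨by simp [hx], fun k => by simp [smul_comm h a, hx']⟩

variable {N h}

theorem tateModule_pow_smul (x : tateModule N h) (k : ℕ) : h ^ k • x.1 k = 0 := by
  induction k with
  | zero => simpa using x.2.1
  | succ k ih => rw [pow_succ, mul_smul, x.2.2 k, ih]

theorem tateModule_smul_eq_zero (x : tateModule N h) (k : ℕ) {a : R}
    (ha : a ∈ (Ideal.span {h} ^ k • ⊤ : Ideal R)) : a • x.1 k = 0 := by
  rw [smul_eq_mul, Ideal.mul_top, Ideal.span_singleton_pow, Ideal.mem_span_singleton] at ha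
  obtain ⟨b, rfl⟩ := ha
  rw [mul_comm, mul_smul, tateModule_pow_smul, smul_zero]

/-- The map `R / h ^ k → N`, `a ↦ a • x_k`, for `x` in the Tate module. -/
def levelSMul (x : tateModule N h) (k : ℕ) : (R ⧸ (Ideal.span {h} ^ k • ⊤ : Ideal R)) →ₗ[R] N :=
  Submodule.liftQ _ (LinearMap.toSpanSingleton R N (x.1 k))
    (fun _ ha => by simpa using tateModule_smul_eq_zero x k ha)

theorem levelSMul_mk (x : tateModule N h) (k : ℕ) (a : R) :
    levelSMul x k (Ideal.Quotient.mk _ a) = a • x.1 k := rfl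

/-- The Tate module is a module over the `h`-adic completion of `R`: `(α • x)_k = α_k • x_k`, where
`α_k` is the class of `α` modulo `h ^ k`. -/
instance : SMul (AdicCompletion (Ideal.span {h}) R) (tateModule N h) where
  smul α x := ⟨fun k => levelSMul x k (α.1 k), by
    constructor
    · obtain ⟨a, ha⟩ := Ideal.Quotient.mk_surjective (α.1 0)
      simp only
      rw [← ha, levelSMul_mk, x.2.1, smul_zero]
    · intro k
      obtain ⟨a, ha⟩ := Ideal.Quotient.mk_surjective (α.1 (k + 1))
      have hk : α.1 k = Ideal.Quotient.mk _ a := by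
        have e := α.2 (Nat.le_add_right k 1)
        rw [← ha] at e
        exact e.symm
      simp only
      rw [hk, ← ha, levelSMul_mk, levelSMul_mk, smul_comm, x.2.2 k]⟩

theorem adic_smul_apply (α : AdicCompletion (Ideal.span {h}) R) (x : tateModule N h) (k : ℕ) :
    (α • x).1 k = levelSMul x k (α.1 k) := rfl

theorem adic_smul_apply_of_mk {α : AdicCompletion (Ideal.span {h}) R} {k : ℕ} {a : R}
    (ha : Ideal.Quotient.mk _ a = α.1 k) (x : tateModule N h) : (α • x).1 k = a • x.1 k := by
  rw [adic_smul_apply, ← ha, levelSMul_mk]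

instance : Module (AdicCompletion (Ideal.span {h}) R) (tateModule N h) where
  one_smul x := by
    ext k
    rw [adic_smul_apply_of_mk (a := 1) rfl, one_smul]
  mul_smul α β x := by
    ext k
    obtain ⟨a, ha⟩ := Ideal.Quotient.mk_surjective (α.1 k)
    obtain ⟨b, hb⟩ := Ideal.Quotient.mk_surjective (β.1 k)
    rw [adic_smul_apply_of_mk (a := a * b) (by rw [map_mul, ha, hb]; rfl),
      adic_smul_apply_of_mk ha, adic_smul_apply_of_mk hb, mul_smul]
  smul_zero α := by
    ext k
    obtain ⟨a, ha⟩ := Ideal.Quotient.mk_surjective (α.1 k)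
    rw [adic_smul_apply_of_mk ha]
    simp
  smul_add α x y := by
    ext k
    obtain ⟨a, ha⟩ := Ideal.Quotient.mk_surjective (α.1 k)
    have e : ((α • x + α • y : tateModule N h)).1 k = (α • x).1 k + (α • y).1 k := rfl
    have e' : ((x + y : tateModule N h)).1 k = x.1 k + y.1 k := rfl
    rw [e, adic_smul_apply_of_mk ha, adic_smul_apply_of_mk ha, adic_smul_apply_of_mk ha, e',
      smul_add]
  add_smul α β x := by
    ext k
    obtain ⟨a, ha⟩ := Ideal.Quotient.mk_surjective (α.1 k)
    obtain ⟨b, hb⟩ := Ideal.Quotient.mk_surjective (β.1 k)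
    have e : ((α • x + β • x : tateModule N h)).1 k = (α • x).1 k + (β • x).1 k := rfl
    rw [e, adic_smul_apply_of_mk (a := a + b) (by rw [map_add, ha, hb]; rfl),
      adic_smul_apply_of_mk ha, adic_smul_apply_of_mk hb, add_smul]
  zero_smul x := by
    ext k
    rw [adic_smul_apply_of_mk (a := 0) rfl, zero_smul]
    rfl

/-- The endomorphism of the Tate module induced by an endomorphism of `N`. -/
def tateMap (h : R) (u : N →ₗ[R] N) :
    tateModule N h →ₗ[AdicCompletion (Ideal.span {h}) R] tateModule N h where
  toFun x := ⟨fun k => u (x.1 k), by simp [x.2.1], fun k => by rw [← map_smul, x.2.2 k]⟩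
  map_add' x y := by
    ext k
    exact map_add u (x.1 k) (y.1 k)
  map_smul' α x := by
    ext k
    obtain ⟨a, ha⟩ := Ideal.Quotient.mk_surjective (α.1 k)
    rw [RingHom.id_apply, adic_smul_apply_of_mk ha]
    change u ((α • x).1 k) = _
    rw [adic_smul_apply_of_mk ha, map_smul]

end Tate

/-! ### The reduction of `φ` and the function `μ` -/

section Reduction

variable {F : Type*} [Field F] [Fintype F] (φ : DrinfeldModule F) (f : MonicIrred F)

/-- An algebraic closure of `A / f A`. -/
abbrev ResClosure := AlgebraicClosure (AdjoinRoot f.1)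

/-- The map `τ : x ↦ x ^ q` on the algebraic closure of `A / f A`. -/
abbrev resFrob : ResClosure f →ₐ[F] ResClosure f :=
  FiniteField.frobeniusAlgHom F (ResClosure f)

/-- The action of `φ_θ` reduced modulo `f` on the algebraic closure of `A / f A`. -/
def redOp : Module.End F (ResClosure f) :=
  skewOp (resFrob f) φ.rank
    (fun i => algebraMap (AdjoinRoot f.1) (ResClosure f) (AdjoinRoot.mk f.1 (φ.coeff i)))

theorem pow_card_pow (c : AdjoinRoot f.1) : c ^ Fintype.card F ^ f.1.natDegree = c := by
  have hfin : Module.Finite F (AdjoinRoot f.1) := f.2.1.finite_adjoinRoot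
  have : Finite (AdjoinRoot f.1) := Module.finite_of_finite F
  have : Fintype (AdjoinRoot f.1) := Fintype.ofFinite _
  have hr : Module.finrank F (AdjoinRoot f.1) = f.1.natDegree := by
    rw [(AdjoinRoot.powerBasis' f.2.1).finrank, AdjoinRoot.powerBasis'_dim]
  have hc : Fintype.card (AdjoinRoot f.1) = Fintype.card F ^ f.1.natDegree := by
    rw [← hr, Module.card_eq_pow_finrank (K := F)]
  rw [← hc, FiniteField.pow_card]

theorem resFrob_pow_apply (m : ℕ) (x : ResClosure f) :
    ((resFrob f).toLinearMap ^ m) x = x ^ Fintype.card F ^ m := by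
  induction m generalizing x with
  | zero => simp
  | succ m ih =>
    rw [pow_succ, Module.End.mul_apply, ih]
    simp [← pow_mul, pow_succ, mul_comm]

theorem redOp_frob (x : ResClosure f) :
    ((resFrob f).toLinearMap ^ f.1.natDegree) (redOp φ f x) =
      redOp φ f (((resFrob f).toLinearMap ^ f.1.natDegree) x) := by
  simp only [redOp, skewOp, LinearMap.sum_apply, map_sum, Module.End.mul_apply,
    LinearMap.mulLeft_apply]
  refine Finset.sum_congr rfl fun i _ => ?_
  rw [resFrob_pow_apply, resFrob_pow_apply, resFrob_pow_apply, resFrob_pow_apply, mul_pow,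
    ← map_pow, pow_card_pow]
  rw [← pow_mul, ← pow_mul, mul_comm (Fintype.card F ^ i)]

/-- The algebraic closure of `A / f A` as an `A`-module through the reduction of `φ`
modulo `f`. -/
abbrev RedModule := Module.AEval' (redOp φ f)

/-- The `A`-linear endomorphism `τ ^ d`, `d = deg f`, of the algebraic closure of `A / f A`, where
`A` acts through the reduction of `φ`. -/
def frobEnd : RedModule φ f →ₗ[F[X]] RedModule φ f :=
  LinearMap.ofAEval _ ((Module.AEval'.of (redOp φ f)).toLinearMap ∘ₗ
    ((resFrob f).toLinearMap ^ f.1.natDegree)) (fun m => by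
      rw [LinearMap.comp_apply, LinearMap.comp_apply, LinearEquiv.coe_coe,
        Module.AEval'.X_smul_of]
      exact congrArg _ (redOp_frob φ f m))

/-- `P ∈ A[x]` is the characteristic polynomial of `τ ^ d` on the Tate module `T_h` of the reduction
of `φ` modulo `f`; this includes that the Tate module is free of finite rank over `A_h`. -/
def IsFrobCharpoly (h : MonicIrred F) (P : F[X][X]) : Prop :=
  ∃ (m : ℕ) (b : Module.Basis (Fin m) (AdicCompletion (Ideal.span {h.1}) F[X])
      (tateModule (RedModule φ f) h.1)),
    (LinearMap.toMatrix b b (tateMap h.1 (frobEnd φ f))).charpoly =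
      P.map (algebraMap F[X] (AdicCompletion (Ideal.span {h.1}) F[X]))

open Classical in
/-- The characteristic polynomial `P_φ(x) = x ^ r₀ + ⋯ + p₁ x + p₀ ∈ A[x]` of `τ ^ d` on the Tate
modules `T_h`, for `h ≠ f` monic irreducible; it is independent of `h`. -/
def frobPoly : F[X][X] :=
  if H : ∃ P : F[X][X], ∀ h : MonicIrred F, h ≠ f → IsFrobCharpoly φ f h P then H.choose else 0

/-- The constant `c(f) ∈ 𝔽_q` for which `p₀ = c(f)⁻¹ f`; as `f` is monic, `c(f)⁻¹` is the leading
coefficient of `p₀`. -/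
def frobConst : F := ((frobPoly φ f).coeff 0).leadingCoeff⁻¹

/-- The polynomial
`D_f(x) = 1 + c(f) p₁ x + c(f) p₂ f x ^ 2 + ⋯ + c(f) f ^ (r₀ - 1) x ^ r₀ ∈ A[x]`.
It is `1` for `r₀ = 0`. -/
def eulerPoly : F[X][X] :=
  1 + ∑ i ∈ Finset.Icc 1 (frobPoly φ f).natDegree,
    C (C (frobConst φ f) * (frobPoly φ f).coeff i * f.1 ^ (i - 1)) * X ^ i

/-- The inverse of `D_f(x)` in `A⟦x⟧`; the constant term of `D_f` is `1`. -/
def eulerSeries : PowerSeries F[X] :=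
  PowerSeries.invOfUnit (eulerPoly φ f : PowerSeries F[X]) 1

/-- The function `μ : A₊ → A` with `∑ μ(a) a ^ (-s) = ∏_f D_f(f ^ (-s)) ⁻¹`, that is, the
multiplicative function whose values at the powers of `f` are given by
`∑ μ(f ^ i) x ^ i = D_f(x) ⁻¹`. -/
def mu (a : MonicPoly F) : F[X] :=
  ∏ᶠ f : MonicIrred F, PowerSeries.coeff (multiplicity f.1 a.1) (eulerSeries φ f)

end Reduction

/-! ### The Drinfeld module `ψ` and its Taelman `L`-value -/

section Psi

variable (F : Type*) [Field F] (n : ℕ)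

/-- The field `𝔽_q(z₁, …, z_n, t)`. -/
abbrev BaseField := FractionRing (MvPolynomial (Fin n ⊕ Unit) F)

/-- The variable `z_j`. -/
def zVar (j : Fin n) : BaseField F n :=
  algebraMap (MvPolynomial (Fin n ⊕ Unit) F) _ (MvPolynomial.X (Sum.inl j))

/-- The variable `t`. -/
def tVar : BaseField F n :=
  algebraMap (MvPolynomial (Fin n ⊕ Unit) F) _ (MvPolynomial.X (Sum.inr ()))

variable {F}

/-- The inclusion of `A = 𝔽_q[θ]` into `𝔽_q(z₁, …, z_n, t)[θ]`. -/
abbrev baseChange (a : F[X]) : (BaseField F n)[X] := a.map (algebraMap F (BaseField F n))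

variable [Fintype F]

/-- `ℓ_i(z) = ∏_{j < i} (z - θ ^ (q ^ j))`, for `z` in `𝔽_q(z₁, …, z_n, t)`. -/
def ell (i : ℕ) (z : BaseField F n) : (BaseField F n)[X] :=
  ∏ j ∈ Finset.range i, (C z - X ^ Fintype.card F ^ j)

/-- The coefficient `ψ_{θ,i} = t ^ i ℓ_i(z₁) ⋯ ℓ_i(z_n) φ_{θ,i}`. -/
def psiCoeff (φ : DrinfeldModule F) (i : ℕ) : (BaseField F n)[X] :=
  C (tVar F n ^ i) * (∏ j : Fin n, ell n i (zVar F n j)) * baseChange n (φ.coeff i)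

/-- The ideal generated by `f` in `𝔽_q(z₁, …, z_n, t)[θ]`. -/
abbrev primeIdeal (f : MonicIrred F) : Ideal (BaseField F n)[X] := Ideal.span {baseChange n f.1}

/-- The quotient of `𝔽_q(z₁, …, z_n, t)[θ]` by `f`. -/
abbrev PrimeQuot (f : MonicIrred F) := (BaseField F n)[X] ⧸ primeIdeal n f

instance (f : MonicIrred F) : Module.Finite (BaseField F n) (PrimeQuot n f) :=
  (f.2.1.map _).finite_quotient

/-- The endomorphism `τ` of `𝔽_q(z₁, …, z_n, t)[θ]`, linear over `𝔽_q(z₁, …, z_n, t)` with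
`τ(θ) = θ ^ q`. -/
abbrev polyFrob : (BaseField F n)[X] →ₐ[BaseField F n] (BaseField F n)[X] :=
  Polynomial.expand (BaseField F n) (Fintype.card F)

theorem polyFrob_baseChange (a : F[X]) :
    polyFrob n (baseChange n a) = baseChange n a ^ Fintype.card F := by
  rw [polyFrob, baseChange, ← Polynomial.map_expand, FiniteField.expand_card, Polynomial.map_pow]

/-- The endomorphism induced by `τ` on the quotient by `f`. -/
def quotFrob (f : MonicIrred F) : PrimeQuot n f →ₐ[BaseField F n] PrimeQuot n f :=
  Ideal.quotientMapₐ (primeIdeal n f) (polyFrob n) (by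
    rw [Ideal.span_singleton_le_iff_mem, Ideal.mem_comap]
    change polyFrob n (baseChange n f.1) ∈ _
    rw [polyFrob_baseChange]
    exact Ideal.pow_mem_of_mem _ (Ideal.mem_span_singleton_self _) _ Fintype.card_pos)

/-- The action of `ψ_θ = ∑ ψ_{θ,i} τ ^ i` on the quotient by `f`. -/
def psiOp (φ : DrinfeldModule F) (f : MonicIrred F) :
    Module.End (BaseField F n) (PrimeQuot n f) :=
  skewOp (quotFrob n f) φ.rank (fun i => Ideal.Quotient.mk (primeIdeal n f) (psiCoeff n φ i))

/-- The `𝔽_q(z₁, …, z_n, t)[θ]`-module given by the quotient by `f` with the action of `ψ`. -/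
abbrev PsiModule (φ : DrinfeldModule F) (f : MonicIrred F) := Module.AEval' (psiOp n φ f)

/-- The inclusion of `k[θ]` into `k((θ⁻¹))`; the variable of the Laurent series is `θ⁻¹`, and
`k((θ⁻¹))` carries the corresponding valuation topology. -/
def toLaurent (k : Type*) [Field k] : k[X] →ₐ[k] LaurentSeries k :=
  Polynomial.aeval (HahnSeries.single (-1 : ℤ) (1 : k) : LaurentSeries k)

/-- The factor at `f` of the product defining the Taelman `L`-value of `ψ`. -/
def taelmanFactor (φ : DrinfeldModule F) (f : MonicIrred F) : LaurentSeries (BaseField F n) :=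
  toLaurent (BaseField F n) (fittingGen (BaseField F n) (PrimeQuot n f)) /
    toLaurent (BaseField F n) (fittingGen (BaseField F n) (PsiModule n φ f))

/-- The Taelman `L`-value of `ψ`. -/
def taelmanLValue (φ : DrinfeldModule F) : LaurentSeries (BaseField F n) :=
  ∏' f : MonicIrred F, taelmanFactor n φ f

/-- The term `μ(a) a(z₁) ⋯ a(z_n) t ^ deg a / a`. -/
def seriesTerm (φ : DrinfeldModule F) (a : MonicPoly F) : LaurentSeries (BaseField F n) :=
  toLaurent (BaseField F n) (baseChange n (mu φ a) *
      C ((∏ j : Fin n, aeval (zVar F n j) a.1) * tVar F n ^ a.1.natDegree)) /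
    toLaurent (BaseField F n) (baseChange n a.1)

end Psi

end TaelmanL

end

noncomputable section

namespace TaelmanL

/-! ### Determinants of polynomial matrices -/

section LinearAlgebra

/-! Fix `f` of degree `d`. In skew polynomials over `A / f` the element `x = τ ^ d` is central, so
right multiplication by the reduction of `φ_θ` is a `d × d` matrix over `(A / f)[x]`. Put `Q_f(T, x)
= det (T - φ_θ)`. Conjugation by `τ` raises the coefficients to the `q`-th power without changing
the determinant, so `Q_f` lies in `𝔽_q[T][x]`; this is `localPoly`. One has `Q_f(T, 0) = f(T)`, and
`Q_f` has degree `r₀` in `x`, with constant leading coefficient if `r₀ > 0`. Both sides of the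
theorem are specializations of `Q_f`.

Tate modules (`isFrobCharpoly_frobCharpoly`): if `r₀ > 0`, then `P_f(x)` is `Q_f(θ, x)` divided by
its leading constant. For `g = h ^ k`, the Anderson generating functions of the `g`-torsion points
satisfy `T ω = ∑ φ_{θ,i} ω^(i)`, their twists span `(k[T] / g) ^ r₀` with `k` the algebraic closure
of `A / f`, and twisting `d` times acts through the matrix of `τ ^ d`. So `T - φ_θ` gives `d`
relations between `d` generators, the characteristic polynomial of `τ ^ d` divides `Q_f` modulo `g`
(`charpoly_dvd_det`), and the degrees agree.

The module `ψ` (`charpoly_psiOp`): the characteristic polynomial of `ψ_θ` modulo `f` is `Q_f(T, t ^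
d f(z₁) ⋯ f(z_n))`. Evaluation at the conjugates of a root of `f`, weighted by `t ^ j ℓ_j(z₁) ⋯
ℓ_j(z_n)`, absorbs the factors `t ^ i ℓ_i`; running once through all conjugates multiplies the
weight by `t ^ d f(z₁) ⋯ f(z_n)`.

Hence `D_f(x) = Q_f(θ, f x) / f`, and the factor of the `L`-value at `f` is `D_f(x_f)⁻¹ = ∑ μ(f ^ i)
x_f ^ i` with `x_f = t ^ d f(z₁) ⋯ f(z_n) / f`. Multiplying out over all `f` gives the series.

Convergence: if `T` has weight `r` and `x` weight `d`, the monomials of `Q_f` have weight at most `r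
d` (`weight_coeff_localPoly_le`). This gives `r deg μ(a) ≤ (r - 1) deg a`, so the term at `a` has
degree at most `-deg a / r` in `θ`. As there are finitely many `a` of each degree, the series is
summable, and then so is every rearrangement into an Euler product. -/

theorem natDegree_det_le {R n : Type*} [CommRing R] [Fintype n] [DecidableEq n]
    (M : Matrix n n R[X]) (r : ℕ) (h : ∀ i j, (M i j).natDegree ≤ r) :
    M.det.natDegree ≤ Fintype.card n * r := by
  rw [Matrix.det_apply]
  refine natDegree_sum_le_of_forall_le _ _ fun σ _ => ?_
  refine (natDegree_smul_le _ _).trans ((natDegree_prod_le _ _).trans ?_)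
  simpa using Finset.sum_le_card_nsmul Finset.univ _ r fun i _ => h (σ i) i

theorem coeff_det_card_mul {R n : Type*} [CommRing R] [Fintype n] [DecidableEq n]
    (M : Matrix n n R[X]) (r : ℕ) (h : ∀ i j, (M i j).natDegree ≤ r) :
    M.det.coeff (Fintype.card n * r) = (M.map fun p => p.coeff r).det := by
  rw [Matrix.det_apply, Matrix.det_apply, finsetSum_coeff]
  refine Finset.sum_congr rfl fun σ _ => ?_
  rw [coeff_smul]
  congr 1
  exact coeff_prod_of_natDegree_le _ _ r fun i _ => h (σ i) i

theorem det_eq_of_mul_eq {R n : Type*} [CommRing R] [IsDomain R] [Fintype n] [DecidableEq n]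
    {W D E : Matrix n n R} (hW : W.det ≠ 0) (h : W * D = E * W) : D.det = E.det := by
  have := congrArg Matrix.det h
  rw [Matrix.det_mul, Matrix.det_mul, mul_comm E.det] at this
  exact mul_left_cancel₀ hW this

variable {S H ι κ : Type*} [CommRing S] [AddCommGroup H] [Module S H] [Fintype ι] [DecidableEq ι]
  [Fintype κ] [DecidableEq κ]

/-- The `S[X]`-linear relations between the elements of an `S`-basis of `H`, where `X` acts
through `u`, are generated by the rows of the characteristic matrix. -/
theorem exists_vecMul_charmatrix (b : Module.Basis ι S H) (u : Module.End S H) (p : ι → S[X])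
    (hp : ∑ i, aeval u (p i) (b i) = 0) :
    ∃ γ : ι → S[X], Matrix.vecMul γ (LinearMap.toMatrix b b u).transpose.charmatrix = p := by
  set N := (LinearMap.toMatrix b b u).transpose.charmatrix
  have hub : ∀ j, u (b j) = ∑ i, LinearMap.toMatrix b b u i j • b i := fun j => by
    conv_lhs => rw [← b.sum_repr (u (b j))]
    simp [LinearMap.toMatrix_apply]
  let ev : (ι → S[X]) →ₗ[S] H := ∑ i, (LinearMap.applyₗ (b i)) ∘ₗ
    (aeval u).toLinearMap ∘ₗ (LinearMap.proj i : (ι → S[X]) →ₗ[S] S[X])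
  have ev_apply : ∀ p, ev p = ∑ i, aeval u (p i) (b i) := fun p => by
    simp [ev, LinearMap.sum_apply]
  let rows : Submodule S[X] (ι → S[X]) := LinearMap.range (Matrix.vecMulLinear N)
  have hrow : ∀ j, (fun i => N j i) ∈ rows :=
    fun j => ⟨Pi.single j 1, by ext i; simp⟩
  -- Modulo the rows, multiplying a constant tuple by `X` amounts to applying `u`, so the result is
  -- again constant.
  have hX : ∀ w : ι → S, ∃ w' : ι → S,
      (fun i => X * C (w i)) - (fun i => C (w' i)) ∈ rows := by
    intro w
    refine ⟨fun i => ∑ j, w j * LinearMap.toMatrix b b u i j, ?_⟩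
    have : (fun i => X * C (w i)) -
        (fun i => C (∑ j, w j * LinearMap.toMatrix b b u i j)) =
        ∑ j, C (w j) • (fun i => N j i) := by
      ext1 i
      simp only [Pi.sub_apply, Finset.sum_apply, Pi.smul_apply, smul_eq_mul, N,
        Matrix.charmatrix_apply, Matrix.transpose_apply, mul_sub, Finset.sum_sub_distrib, map_sum,
        map_mul]
      congr 1
      rw [Finset.sum_eq_single i]
      · rw [Matrix.diagonal_apply_eq, mul_comm]
      · intro j _ hji
        rw [Matrix.diagonal_apply_ne _ hji, mul_zero]
      · simp
    rw [this]
    exact Submodule.sum_mem _ fun j _ => rows.smul_mem _ (hrow j)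
  -- Hence every tuple is congruent to a constant one. A relation thereby becomes a constant
  -- relation, which is trivial because `b` is a basis.
  have hred : ∀ p : ι → S[X], ∃ w : ι → S, p - (fun i => C (w i)) ∈ rows := by
    have hsingle : ∀ (p : S[X]) (i : ι), ∃ w : ι → S,
        Pi.single i p - (fun i => C (w i)) ∈ rows := by
      intro p i
      induction p using Polynomial.induction_on' with
      | add p q hp hq =>
        obtain ⟨w, hw⟩ := hp
        obtain ⟨w', hw'⟩ := hq
        refine ⟨w + w', ?_⟩
        convert rows.add_mem hw hw' using 1
        ext1 j
        simp [Pi.single_add]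
        ring
      | monomial m a =>
        induction m with
        | zero =>
          refine ⟨Pi.single i a, ?_⟩
          convert rows.zero_mem using 1
          ext1 j
          by_cases h : j = i
          · subst h; simp
          · simp [h]
        | succ m ih =>
          obtain ⟨w, hw⟩ := ih
          obtain ⟨w', hw'⟩ := hX w
          refine ⟨w', ?_⟩
          convert rows.add_mem (rows.smul_mem X hw) hw' using 1
          ext1 j
          by_cases h : j = i
          · subst h; simp [mul_sub, X_mul_monomial]
          · simp [h]
            ring
    intro p
    choose w hw using fun i => hsingle (p i) i
    refine ⟨∑ i, w i, ?_⟩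
    convert rows.sum_mem fun i (_ : i ∈ Finset.univ) => hw i using 1
    ext1 j
    simp [Finset.sum_apply, Finset.sum_sub_distrib]
  have hker : ∀ p ∈ rows, ev p = 0 := by
    rintro _ ⟨γ, rfl⟩
    rw [ev_apply]
    simp only [Matrix.vecMulLinear_apply, Matrix.vecMul, dotProduct, map_sum, LinearMap.sum_apply,
      map_mul]
    rw [Finset.sum_comm]
    refine Finset.sum_eq_zero fun j _ => ?_
    simp only [Module.End.mul_apply, ← map_sum]
    convert map_zero (aeval u (γ j))
    simp only [N, Matrix.charmatrix_apply, Matrix.transpose_apply, map_sub, LinearMap.sub_apply,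
      Finset.sum_sub_distrib, aeval_C, Module.algebraMap_end_apply]
    rw [← hub, sub_eq_zero]
    rw [Finset.sum_eq_single j]
    · simp
    · intro i _ hij
      simp [hij.symm]
    · simp
  obtain ⟨w, hw⟩ := hred p
  have h0 := hker _ hw
  rw [map_sub, ev_apply, hp, zero_sub, neg_eq_zero, ev_apply] at h0
  simp only [aeval_C, Module.algebraMap_end_apply] at h0
  have hw0 : ∀ i, w i = 0 := Fintype.linearIndependent_iff.mp b.linearIndependent w h0
  have : p - (fun i => C (w i)) = p := by ext1 i; simp [hw0]
  rw [this] at hw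
  exact hw

/-- If the elements `v j` generate `H` over `S[X]`, where `X` acts through `u`, and the rows of the
square matrix `D` are relations between them, then the characteristic polynomial of `u` divides
the determinant of `D`. -/
theorem charpoly_dvd_det (b : Module.Basis ι S H) (u : Module.End S H) (v : κ → H)
    (D : Matrix κ κ S[X])
    (hspan : ∀ w : H, ∃ β : κ → S[X], ∑ j, aeval u (β j) (v j) = w)
    (hD : ∀ j, ∑ l, aeval u (D j l) (v l) = 0) :
    (LinearMap.toMatrix b b u).charpoly ∣ D.det := by
  choose β hβ using fun i => hspan (b i)
  set N := (LinearMap.toMatrix b b u).transpose.charmatrix with hN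
  let α : Matrix κ ι S[X] := Matrix.of fun j i => C (b.repr (v j) i)
  have hα : ∀ j, ∑ i, aeval u (α j i) (b i) = v j := fun j => by
    simp [α, b.sum_repr]
  have hmul : ∀ q : κ → S[X], ∑ i, aeval u (∑ l, q l * α l i) (b i) =
      ∑ l, aeval u (q l) (v l) := by
    intro q
    simp only [map_sum, LinearMap.sum_apply, map_mul, Module.End.mul_apply]
    rw [Finset.sum_comm]
    refine Finset.sum_congr rfl fun l _ => ?_
    rw [← map_sum, hα]
  choose γ₁ hγ₁ using fun j => exists_vecMul_charmatrix b u (fun i => ∑ l, D j l * α l i)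
    ((hmul _).trans (hD j))
  choose γ₂ hγ₂ using fun i₀ => exists_vecMul_charmatrix b u
    (fun i => (1 : Matrix ι ι S[X]) i₀ i - ∑ l, β i₀ l * α l i) (by
      simp only [map_sub, LinearMap.sub_apply, Finset.sum_sub_distrib]
      rw [hmul, hβ, sub_eq_zero, Finset.sum_eq_single i₀]
      · simp
      · intro i _ hi
        simp [hi.symm]
      · simp)
  -- Take the `v j` and the `b i` together as generators. All relations between them come from the
  -- rows of `(1, -α)` and `(0, N)`; the rows of `(D, 0)` and `(-β, 1)` are particular relations,
  -- hence combinations of those. Taking determinants gives the divisibility.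
  have key : Matrix.fromBlocks D 0 (-Matrix.of β) 1 =
      Matrix.fromBlocks D (Matrix.of γ₁) (-Matrix.of β) (Matrix.of γ₂) *
        Matrix.fromBlocks 1 (-α) 0 N := by
    rw [Matrix.fromBlocks_multiply]
    congr 1
    · simp
    · ext1 j i
      have := congrFun (hγ₁ j) i
      simp only [Matrix.add_apply, Matrix.mul_apply, Matrix.neg_apply, mul_neg,
        Finset.sum_neg_distrib, Matrix.zero_apply, Matrix.of_apply]
      rw [← this]
      simp [Matrix.vecMul, dotProduct, hN]
    · simp
    · ext1 j i
      have := congrFun (hγ₂ j) i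
      simp only [Matrix.vecMul, dotProduct] at this
      simp only [Matrix.add_apply, Matrix.mul_apply, Matrix.neg_apply, mul_neg, neg_mul, neg_neg,
        Matrix.of_apply]
      rw [hN, this]
      ring
  have hdet := congrArg Matrix.det key
  rw [Matrix.det_mul, Matrix.det_fromBlocks_zero₁₂, Matrix.det_fromBlocks_zero₂₁, Matrix.det_one,
    mul_one, Matrix.det_one, one_mul] at hdet
  rw [← Matrix.charpoly_transpose, Matrix.charpoly, hdet]
  exact dvd_mul_left _ _

end LinearAlgebra

/-! ### Twisted cyclic matrices -/

section Twist

variable {B : Type*} [CommRing B]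

/-- The `d × d` matrix of the cyclic shift whose `d`-th power is multiplication by `x`. -/
def shiftMatrix (d : ℕ) (x : B) : Matrix (Fin d) (Fin d) B :=
  Matrix.of fun j l => if (l : ℕ) = j + 1 then 1 else if (j : ℕ) + 1 = d ∧ (l : ℕ) = 0 then x else 0

/-- The diagonal matrix with entries `a, a ^ q, a ^ (q ^ 2), …`. -/
def twistDiag (q d : ℕ) (a : B) : Matrix (Fin d) (Fin d) B :=
  Matrix.diagonal fun j => a ^ q ^ (j : ℕ)

/-- The matrix of right multiplication by `c₀ + c₁ τ + ⋯ + c_r τ ^ r` on skew polynomials in `τ`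
in the basis `1, τ, …, τ ^ (d - 1)`, where `τ ^ d` acts as `x`. -/
def twistMatrix (q d r : ℕ) (c : ℕ → B) (x : B) : Matrix (Fin d) (Fin d) B :=
  ∑ i ∈ Finset.range (r + 1), twistDiag q d (c i) * shiftMatrix d x ^ i

/-- The determinant of `T - twistMatrix q d r c x`. -/
def twistDet (q d r : ℕ) (c : ℕ → B) (T x : B) : B :=
  (Matrix.scalar (Fin d) T - twistMatrix q d r c x).det

variable {B' : Type*} [CommRing B'] (φ : B →+* B')

theorem map_shiftMatrix (d : ℕ) (x : B) :
    φ.mapMatrix (shiftMatrix d x) = shiftMatrix d (φ x) := by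
  ext j l
  simp only [shiftMatrix, RingHom.mapMatrix_apply, Matrix.map_apply, Matrix.of_apply]
  split_ifs <;> simp

theorem map_twistDiag (q d : ℕ) (a : B) :
    φ.mapMatrix (twistDiag q d a) = twistDiag q d (φ a) := by
  ext j l
  simp only [twistDiag, RingHom.mapMatrix_apply, Matrix.map_apply, Matrix.diagonal_apply]
  split_ifs <;> simp

theorem map_twistMatrix (q d r : ℕ) (c : ℕ → B) (x : B) :
    φ.mapMatrix (twistMatrix q d r c x) = twistMatrix q d r (fun i => φ (c i)) (φ x) := by
  simp only [twistMatrix, map_sum, map_mul, map_pow, map_shiftMatrix, map_twistDiag]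

theorem map_twistDet (q d r : ℕ) (c : ℕ → B) (T x : B) :
    φ (twistDet q d r c T x) = twistDet q d r (fun i => φ (c i)) (φ T) (φ x) := by
  rw [twistDet, RingHom.map_det, map_sub, map_twistMatrix, twistDet]
  congr 2
  ext j l
  by_cases h : j = l
  · subst h; simp
  · simp [h]

theorem twistMatrix_eq_of_le (q d : ℕ) {r r' : ℕ} (h : r ≤ r') (hq : 0 < q) (c : ℕ → B)
    (hc : ∀ i, r < i → c i = 0) (x : B) : twistMatrix q d r' c x = twistMatrix q d r c x := by
  symm
  refine Finset.sum_subset (Finset.range_mono (by omega)) fun i _ hi => ?_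
  rw [hc i (by simpa using hi)]
  have : twistDiag q d (0 : B) = 0 := by
    simp only [twistDiag, zero_pow (pow_pos hq _).ne', Matrix.diagonal_zero]
  rw [this, zero_mul]

section Sequence

variable {H : Type*} [AddCommGroup H] [Module B H] {d : ℕ} {x : B} {v : ℕ → H}

theorem shiftMatrix_smul (hd : 0 < d) (hv : ∀ n, v (n + d) = x • v n) (j : Fin d) :
    ∑ l, shiftMatrix d x j l • v l = v (j + 1) := by
  by_cases h : (j : ℕ) + 1 < d
  · rw [Finset.sum_eq_single ⟨j + 1, h⟩]
    · simp [shiftMatrix]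
    · intro l _ hl
      have h1 : ¬ (l : ℕ) = j + 1 := fun e => hl (Fin.ext e)
      have h2 : ¬ (j : ℕ) + 1 = d := h.ne
      simp [shiftMatrix, h1, h2]
    · simp
  · have h3 : (j : ℕ) + 1 = d := by omega
    rw [Finset.sum_eq_single ⟨0, hd⟩]
    · have h1 : ¬ 0 = d := hd.ne
      simp [shiftMatrix, h3, h1, ← hv]
    · intro l _ hl
      have h1 : ¬ (l : ℕ) = d := by omega
      have h2 : ¬ (l : ℕ) = 0 := fun e => hl (Fin.ext e)
      simp [shiftMatrix, h1, h2, h3]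
    · simp

theorem mul_smul_vec (M N : Matrix (Fin d) (Fin d) B) (w : Fin d → H) (j : Fin d) :
    ∑ l, (M * N) j l • w l = ∑ k, M j k • ∑ l, N k l • w l := by
  simp only [Matrix.mul_apply, Finset.sum_smul, Finset.smul_sum, mul_smul]
  exact Finset.sum_comm

theorem shiftMatrix_pow_smul (hd : 0 < d) (hv : ∀ n, v (n + d) = x • v n) (i : ℕ) (j : Fin d) :
    ∑ l, (shiftMatrix d x ^ i) j l • v l = v (j + i) := by
  induction i generalizing v with
  | zero =>
    rw [Finset.sum_eq_single j] <;> simp +contextual [eq_comm]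
  | succ i ih =>
    rw [pow_succ, mul_smul_vec]
    simp only [shiftMatrix_smul hd hv]
    rw [ih (v := fun n => v (n + 1)) fun n => by rw [← hv, add_right_comm]]
    rfl

/-- This is how the matrix is used below: any sequence on which a shift by `d` is multiplication by
`x` turns a relation twisted by the Frobenius into a row of `twistMatrix`. It is applied both to
generating functions and to evaluations at conjugates. -/
theorem twistMatrix_smul (hd : 0 < d) (hv : ∀ n, v (n + d) = x • v n) (q r : ℕ) (c : ℕ → B)
    (j : Fin d) :
    ∑ l, twistMatrix q d r c x j l • v l =
      ∑ i ∈ Finset.range (r + 1), c i ^ q ^ (j : ℕ) • v (j + i) := by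
  simp only [twistMatrix, Matrix.sum_apply, Finset.sum_smul]
  rw [Finset.sum_comm]
  refine Finset.sum_congr rfl fun i _ => ?_
  rw [mul_smul_vec, Finset.sum_eq_single j]
  · rw [shiftMatrix_pow_smul hd hv]
    simp [twistDiag]
  · intro l _ hl
    simp [twistDiag, hl.symm]
  · simp

end Sequence

theorem shiftMatrix_pow_self {d : ℕ} (hd : 0 < d) (x : B) :
    shiftMatrix d x ^ d = Matrix.scalar (Fin d) x := by
  ext j m
  -- This test sequence picks out column `m`: its first `d` terms form the `m`-th unit vector.
  have := shiftMatrix_pow_smul (x := x) (H := B) hd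
    (v := fun n => x ^ (n / d) * if n % d = m then 1 else 0)
    (fun n => by simp [Nat.add_div_right _ hd, pow_succ']) d j
  simp only [Nat.add_div_right _ hd, Nat.add_mod_right, Nat.div_eq_of_lt (Fin.is_lt _),
    Nat.mod_eq_of_lt (Fin.is_lt _), pow_zero, smul_eq_mul, mul_ite, mul_one, mul_zero,
    zero_add, pow_one] at this
  rw [Finset.sum_eq_single m] at this
  · simpa [Matrix.diagonal_apply, Fin.ext_iff] using this
  · intro l _ hl
    rw [if_neg (fun e => hl (Fin.ext e))]
  · simp

theorem det_shiftMatrix_ne_zero [IsDomain B] {d : ℕ} (hd : 0 < d) {x : B} (hx : x ≠ 0) :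
    (shiftMatrix d x).det ≠ 0 := by
  have h := congrArg Matrix.det (shiftMatrix_pow_self hd x)
  rw [Matrix.det_pow, Matrix.scalar_apply, Matrix.det_diagonal] at h
  intro h0
  rw [h0, zero_pow hd.ne'] at h
  exact Finset.prod_ne_zero_iff.mpr (fun _ _ => hx) h.symm

/-- This is the commutation rule `τ a = a ^ q τ`. The hypothesis on `a` is needed for the entry that
wraps around from `d - 1` to `0`. -/
theorem shiftMatrix_mul_twistDiag {q d : ℕ} {a : B} (ha : a ^ q ^ d = a) (x : B) :
    shiftMatrix d x * twistDiag q d a = twistDiag q d (a ^ q) * shiftMatrix d x := by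
  ext j l
  simp only [twistDiag, Matrix.mul_diagonal, Matrix.diagonal_mul, shiftMatrix, Matrix.of_apply]
  rw [← pow_mul, ← pow_succ', mul_comm]
  split_ifs with h1 h2
  · rw [h1]
  · rw [h2.1, h2.2, ha]; simp
  · simp

/-- Conjugating by the shift, that is by `τ`, raises all coefficients to the `q`-th power. This is
what makes the determinant descend to `𝔽_q`. -/
theorem twistDet_pow [IsDomain B] {q d : ℕ} (hd : 0 < d) (r : ℕ) {c : ℕ → B}
    (hc : ∀ i, c i ^ q ^ d = c i) (T : B) {x : B} (hx : x ≠ 0) :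
    twistDet q d r (fun i => c i ^ q) T x = twistDet q d r c T x := by
  symm
  refine det_eq_of_mul_eq (det_shiftMatrix_ne_zero hd hx) ?_
  rw [mul_sub, sub_mul, twistMatrix, twistMatrix, Finset.mul_sum, Finset.sum_mul]
  congr 1
  · exact ((Matrix.scalar_commute T (fun _ => Commute.all _ _) _).eq).symm
  · refine Finset.sum_congr rfl fun i _ => ?_
    rw [← mul_assoc, shiftMatrix_mul_twistDiag (hc i), mul_assoc, mul_assoc, ← pow_succ, ← pow_succ']

theorem shiftMatrix_pow_mul_diagonal (d : ℕ) (y : B) (i : ℕ) :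
    shiftMatrix d (y ^ d) ^ i * Matrix.diagonal (fun j : Fin d => y ^ (j : ℕ)) =
      Matrix.diagonal (fun j : Fin d => y ^ (j : ℕ)) * (y ^ i • shiftMatrix d (1 : B) ^ i) := by
  induction i with
  | zero => simp
  | succ i ih =>
    have h1 : shiftMatrix d (y ^ d) * Matrix.diagonal (fun j : Fin d => y ^ (j : ℕ)) =
        Matrix.diagonal (fun j : Fin d => y ^ (j : ℕ)) * (y • shiftMatrix d (1 : B)) := by
      ext j l
      simp only [Matrix.mul_diagonal, Matrix.diagonal_mul, shiftMatrix, Matrix.of_apply,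
        Matrix.smul_apply, smul_eq_mul]
      split_ifs with h h'
      · rw [h]; ring
      · have : y ^ d = y ^ (j : ℕ) * y := by rw [← pow_succ, h'.1]
        rw [h'.2, this]; ring
      · simp
    rw [pow_succ, mul_assoc, h1, ← mul_assoc, ih, mul_assoc, pow_succ, pow_succ]
    simp [smul_smul, mul_comm]

/-- Adjoin a `d`-th root `y` of `x` and conjugate by `diag (1, y, …, y ^ (d - 1))`: the shift
becomes `y` times a constant matrix, so the entries have degree at most `r` in `y`. All degree
bounds on the determinant come from this form. -/
theorem twistDet_expand [IsDomain B] (q d r : ℕ) (c : ℕ → B) (T : B) {y : B} (hy : y ≠ 0) :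
    twistDet q d r c T (y ^ d) = (Matrix.scalar (Fin d) T - ∑ i ∈ Finset.range (r + 1),
      y ^ i • (twistDiag q d (c i) * shiftMatrix d (1 : B) ^ i)).det := by
  symm
  refine det_eq_of_mul_eq (W := Matrix.diagonal (fun j : Fin d => y ^ (j : ℕ))) ?_ ?_
  · rw [Matrix.det_diagonal]
    exact Finset.prod_ne_zero_iff.mpr fun _ _ => pow_ne_zero _ hy
  · rw [mul_sub, sub_mul, twistMatrix, Finset.mul_sum, Finset.sum_mul]
    congr 1
    · exact ((Matrix.scalar_commute T (fun _ => Commute.all _ _) _).eq).symm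
    · refine Finset.sum_congr rfl fun i _ => ?_
      rw [mul_assoc, shiftMatrix_pow_mul_diagonal, ← mul_assoc, mul_smul_comm, mul_smul_comm,
        ← mul_assoc, twistDiag, Matrix.diagonal_mul_diagonal, Matrix.diagonal_mul_diagonal]
      simp only [mul_comm]

end Twist

/-! ### The determinant `det (T - φ_θ)` as a polynomial in `x = τ ^ d` -/

section Generic

variable {K : Type*} [Field K]

/-- The determinant of `T - twistMatrix q d r c x` as a polynomial in `x` over `K[T]`. -/
def twistPoly (q d r : ℕ) (c : ℕ → K) : K[X][X] :=
  twistDet q d r (fun i => C (C (c i))) (C X) X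

/-- The matrix over `K[T][y]` whose determinant is the value of `twistPoly` at `x = y ^ d`. -/
def twistRootMatrix (q d r : ℕ) (c : ℕ → K) : Matrix (Fin d) (Fin d) K[X][X] :=
  Matrix.scalar (Fin d) (C X) - ∑ i ∈ Finset.range (r + 1),
    (X : K[X][X]) ^ i •
      (C.comp C : K →+* K[X][X]).mapMatrix (twistDiag q d (c i) * shiftMatrix d (1 : K) ^ i)

theorem expand_twistPoly {d : ℕ} (q r : ℕ) (c : ℕ → K) :
    expand K[X] d (twistPoly q d r c) = (twistRootMatrix q d r c).det := by
  change (expand K[X] d : K[X][X] →+* K[X][X]) _ = _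
  rw [twistPoly, map_twistDet, twistRootMatrix]
  simp only [RingHom.coe_coe, expand_C, expand_X]
  rw [twistDet_expand _ _ _ _ _ X_ne_zero]
  simp only [map_mul, map_pow, map_twistDiag, map_shiftMatrix, map_one, RingHom.comp_apply]

theorem twistRootMatrix_apply (q d r : ℕ) (c : ℕ → K) (j l : Fin d) :
    twistRootMatrix q d r c j l = C (if j = l then X else 0) -
      ∑ i ∈ Finset.range (r + 1),
        C (C ((twistDiag q d (c i) * shiftMatrix d (1 : K) ^ i) j l)) * X ^ i := by
  simp only [twistRootMatrix, Matrix.sub_apply, Matrix.sum_apply, Matrix.smul_apply,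
    RingHom.mapMatrix_apply, Matrix.map_apply, smul_eq_mul, RingHom.comp_apply,
    Matrix.scalar_apply, Matrix.diagonal_apply]
  congr 1
  · split_ifs <;> simp
  · exact Finset.sum_congr rfl fun i _ => mul_comm _ _

theorem coeff_twistRootMatrix (q d r : ℕ) (c : ℕ → K) (j l : Fin d) (n : ℕ) :
    (twistRootMatrix q d r c j l).coeff n = (if n = 0 then (if j = l then X else 0) else 0) -
      if n < r + 1 then C ((twistDiag q d (c n) * shiftMatrix d (1 : K) ^ n) j l) else 0 := by
  rw [twistRootMatrix_apply]
  simp only [coeff_sub, coeff_C, finsetSum_coeff, coeff_C_mul, coeff_X_pow, mul_ite, mul_one,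
    mul_zero, Finset.sum_ite_eq, Finset.mem_range]

theorem natDegree_twistRootMatrix_le (q d r : ℕ) (c : ℕ → K) (j l : Fin d) :
    (twistRootMatrix q d r c j l).natDegree ≤ r := by
  rw [natDegree_le_iff_coeff_eq_zero]
  intro n hn
  rw [coeff_twistRootMatrix, if_neg (by omega), if_neg (by omega), sub_zero]

theorem coeff_twistPoly {d : ℕ} (hd : 0 < d) (q r : ℕ) (c : ℕ → K) (i : ℕ) :
    (twistPoly q d r c).coeff i = (twistRootMatrix q d r c).det.coeff (d * i) := by
  rw [← expand_twistPoly, mul_comm, coeff_expand_mul hd]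

/-- A `d × d` determinant with entries of degree at most `r` in `y` has degree at most `d r` in `y`,
hence at most `r` in `x = y ^ d`. -/
theorem natDegree_twistPoly_le {d : ℕ} (hd : 0 < d) (q r : ℕ) (c : ℕ → K) :
    (twistPoly q d r c).natDegree ≤ r := by
  have h := natDegree_det_le _ r (natDegree_twistRootMatrix_le q d r c)
  rw [← expand_twistPoly, natDegree_expand, Fintype.card_fin, mul_comm] at h
  exact le_of_mul_le_mul_left h hd

/-- The leading coefficient of `twistPoly` is a nonzero constant. -/
theorem coeff_twistPoly_rank {q d r : ℕ} (hd : 0 < d) (hr : 0 < r) {c : ℕ → K}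
    (hc : c r ≠ 0) : ∃ a : K, a ≠ 0 ∧ (twistPoly q d r c).coeff r = C a := by
  have h := coeff_det_card_mul _ r (natDegree_twistRootMatrix_le q d r c)
  rw [Fintype.card_fin, ← coeff_twistPoly hd] at h
  -- As `r > 0`, the entries `T`, which sit in degree `0` in `y`, do not contribute to degree `r`;
  -- the matrix of top coefficients is constant and invertible.
  have e : (twistRootMatrix q d r c).map (fun p => p.coeff r) =
      (C : K →+* K[X]).mapMatrix (-(twistDiag q d (c r) * shiftMatrix d (1 : K) ^ r)) := by
    ext1 j l
    rw [Matrix.map_apply, coeff_twistRootMatrix, if_neg hr.ne', if_pos (by omega)]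
    simp
  rw [e, ← RingHom.map_det] at h
  refine ⟨_, ?_, h⟩
  rw [Matrix.det_neg, Matrix.det_mul, Matrix.det_pow, twistDiag, Matrix.det_diagonal]
  refine mul_ne_zero (pow_ne_zero _ (by simp)) (mul_ne_zero ?_ (pow_ne_zero _ ?_))
  · exact Finset.prod_ne_zero_iff.mpr fun _ _ => pow_ne_zero _ hc
  · exact det_shiftMatrix_ne_zero hd one_ne_zero

/-- At `y = 0` only the term `i = 0` survives, and the matrix is diagonal. -/
theorem coeff_zero_twistPoly {d : ℕ} (hd : 0 < d) (q r : ℕ) (c : ℕ → K) :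
    (twistPoly q d r c).coeff 0 = ∏ j : Fin d, (X - C (c 0 ^ q ^ (j : ℕ))) := by
  rw [coeff_twistPoly hd, mul_zero, ← constantCoeff_apply, RingHom.map_det,
    ← Matrix.det_diagonal]
  congr 1
  ext1 j l
  rw [RingHom.mapMatrix_apply, Matrix.map_apply, constantCoeff_apply, coeff_twistRootMatrix]
  by_cases h : j = l
  · subst h; simp [twistDiag]
  · simp [h, twistDiag]

/-- Substitution of `T ^ r` for `T` and of `y T` for `y`. -/
def weightHom (K : Type*) [Field K] (r : ℕ) : K[X][X] →+* K[X][X] :=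
  eval₂RingHom (eval₂RingHom (C.comp C) (X ^ r)) (C X * X)

/-- After the substitution the outer variable counts the weight and the inner one remembers the
degree in `y`, so distinct monomials stay distinct and an outer degree bound is a bound on weights.
-/
theorem coeff_coeff_weightHom (r : ℕ) (p : K[X][X]) (n i : ℕ) :
    ((weightHom K r p).coeff (n + i)).coeff i = (expand K r (p.coeff i)).coeff n := by
  induction p using Polynomial.induction_on' with
  | add p q hp hq => simp [hp, hq]
  | monomial m a =>
    have h : weightHom K r (monomial m a) = (expand K r a).map C * C (X ^ m) * X ^ m := by
      rw [weightHom, coe_eval₂RingHom, eval₂_monomial, coe_eval₂RingHom, mul_pow, ← C_pow,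
        ← mul_assoc, expand_eq_sum, eval₂_eq_sum]
      simp [Polynomial.sum, Polynomial.map_sum]
    rw [h]
    by_cases him : m = i
    · subst him
      rw [coeff_mul_X_pow, coeff_mul_C, coeff_map, coeff_C_mul, coeff_X_pow]
      simp
    · rw [coeff_monomial_of_ne _ (Ne.symm him), coeff_mul_X_pow']
      split_ifs
      · rw [coeff_mul_C, coeff_map, coeff_C_mul, coeff_X_pow, if_neg (Ne.symm him)]
        simp
      · simp

/-- With `T` of weight `r` and `x` of weight `d`, all monomials of `twistPoly` have weight at most
`r d`. -/
theorem weight_coeff_twistPoly_le {d : ℕ} (hd : 0 < d) {r : ℕ} (hr : 0 < r) (q : ℕ)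
    (c : ℕ → K) {i : ℕ} (hi : (twistPoly q d r c).coeff i ≠ 0) :
    r * ((twistPoly q d r c).coeff i).natDegree + d * i ≤ r * d := by
  have h := natDegree_det_le ((weightHom K r).mapMatrix (twistRootMatrix q d r c)) r (by
    intro j l
    rw [RingHom.mapMatrix_apply, Matrix.map_apply, twistRootMatrix_apply, map_sub, map_sum]
    refine (natDegree_sub_le _ _).trans (max_le ?_ ?_)
    · rw [weightHom, coe_eval₂RingHom, eval₂_C, coe_eval₂RingHom]
      split_ifs
      · rw [eval₂_X]; exact natDegree_X_pow_le _
      · simp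
    · refine natDegree_sum_le_of_forall_le _ _ fun i hi => ?_
      rw [map_mul, map_pow, weightHom, coe_eval₂RingHom, eval₂_C, coe_eval₂RingHom, eval₂_C,
        eval₂_X, mul_pow, ← mul_assoc, ← C_pow, RingHom.comp_apply, ← C_mul]
      exact (natDegree_C_mul_X_pow_le _ _).trans (by simpa [Nat.lt_succ_iff] using hi))
  rw [← RingHom.map_det, ← expand_twistPoly, Fintype.card_fin] at h
  have h2 := coeff_coeff_weightHom r (expand K[X] d (twistPoly q d r c))
    (((twistPoly q d r c).coeff i).natDegree * r) (i * d)
  rw [coeff_expand_mul hd, coeff_expand_mul hr] at h2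
  by_contra hlt
  rw [coeff_eq_zero_of_natDegree_lt (p := weightHom K r _), coeff_zero] at h2
  · exact hi (leadingCoeff_eq_zero.mp h2.symm)
  · refine h.trans_lt ?_
    push Not at hlt
    nlinarith

end Generic

/-! ### Descent of the determinant to `𝔽_q` -/

section Descent

variable {F K : Type*} [Field F] [Fintype F] [Field K] [Algebra F K]

/-- The polynomial `X ^ q - X` already splits over `F`, so it has no further roots in `K`. -/
theorem mem_range_algebraMap_of_pow_card {a : K} (ha : a ^ Fintype.card F = a) :
    a ∈ (algebraMap F K).range := by
  have hq : 1 < Fintype.card F := Fintype.one_lt_card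
  have h1 : (X ^ Fintype.card F - X : F[X]).Splits := by
    rw [splits_iff_card_roots, FiniteField.roots_X_pow_card_sub_X,
      FiniteField.X_pow_card_sub_X_natDegree_eq _ hq]
    rfl
  exact h1.mem_range_of_isRoot (FiniteField.X_pow_card_sub_X_ne_zero _ hq) (by simp [ha])

/-- `twistPoly` has coefficients in the fixed field of the Frobenius. -/
theorem exists_map_eq_twistPoly {d : ℕ} (hd : 0 < d)
    (hK : ∀ a : K, a ^ Fintype.card F ^ d = a) (r : ℕ) (c : ℕ → K) :
    ∃ Q : F[X][X], Q.map (mapRingHom (algebraMap F K)) = twistPoly (Fintype.card F) d r c := by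
  have h : (twistPoly (Fintype.card F) d r c).map
      (mapRingHom (FiniteField.frobeniusAlgHom F K : K →+* K)) =
      twistPoly (Fintype.card F) d r c := by
    rw [← coe_mapRingHom, twistPoly, map_twistDet]
    simp only [coe_mapRingHom, map_C, map_X, RingHom.coe_coe, FiniteField.coe_frobeniusAlgHom,
      C_pow]
    exact twistDet_pow hd r (fun i => by rw [← C_pow, ← C_pow, hK]) _ X_ne_zero
  refine (mem_map_range (mapRingHom (algebraMap F K))).mpr fun i =>
    (mem_map_range (algebraMap F K)).mpr fun j => mem_range_algebraMap_of_pow_card ?_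
  conv_rhs => rw [← h]
  rw [coeff_map, coe_mapRingHom, coeff_map]
  rfl

end Descent

/-! ### The polynomial `Q_f(T, x)` attached to a prime `f` -/

section Local

variable {F : Type*} [Field F] (φ : DrinfeldModule F) (f : MonicIrred F)

theorem natDegree_pos : 0 < f.1.natDegree := f.2.2.natDegree_pos

theorem finrank_adjoinRoot : Module.finrank F (AdjoinRoot f.1) = f.1.natDegree := by
  rw [(AdjoinRoot.powerBasis' f.2.1).finrank, AdjoinRoot.powerBasis'_dim]

theorem map_adjoinRoot_injective :
    Function.Injective (Polynomial.map (algebraMap F (AdjoinRoot f.1))) :=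
  map_injective _ (algebraMap F (AdjoinRoot f.1)).injective

/-- The coefficients of the reduction of `φ_θ` modulo `f`. -/
def redCoeff (i : ℕ) : AdjoinRoot f.1 := AdjoinRoot.mk f.1 (φ.coeff i)

open Classical in
/-- The rank `r₀` of the reduction of `φ` modulo `f`. -/
def redRank : ℕ := Nat.findGreatest (fun i => redCoeff φ f i ≠ 0) φ.rank

theorem redRank_le : redRank φ f ≤ φ.rank := Nat.findGreatest_le _

/-- Positivity matters: for rank `0` the coefficient is the class of `θ`, which vanishes when `f =
θ`. -/
theorem redCoeff_redRank (h : 0 < redRank φ f) : redCoeff φ f (redRank φ f) ≠ 0 :=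
  Nat.findGreatest_of_ne_zero (P := fun i => redCoeff φ f i ≠ 0) rfl h.ne'

theorem redCoeff_of_gt {i : ℕ} (h : redRank φ f < i) : redCoeff φ f i = 0 := by
  by_cases hi : i ≤ φ.rank
  · by_contra h0
    exact Nat.findGreatest_is_greatest (P := fun i => redCoeff φ f i ≠ 0) h hi h0
  · rw [redCoeff, φ.coeff_of_gt i (by omega), map_zero]

theorem redCoeff_zero : redCoeff φ f 0 = AdjoinRoot.root f.1 := by
  rw [redCoeff, φ.coeff_zero, AdjoinRoot.mk_X]

variable [Fintype F]

/-- The first `d` powers of the Frobenius are distinct automorphisms of `A / f`, and an automorphism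
over `F` is determined by its value at the root. -/
theorem root_pow_card_pow_injective :
    Function.Injective fun j : Fin f.1.natDegree =>
      AdjoinRoot.root f.1 ^ Fintype.card F ^ (j : ℕ) := by
  have : Module.Finite F (AdjoinRoot f.1) := f.2.1.finite_adjoinRoot
  have hfin : Finite (AdjoinRoot f.1) := Module.finite_of_finite F
  have hpow : ∀ (m : ℕ) (x : AdjoinRoot f.1),
      (FiniteField.frobeniusAlgHom F (AdjoinRoot f.1) ^ m) x = x ^ Fintype.card F ^ m := by
    intro m
    induction m with
    | zero => simp
    | succ m ih =>
      intro x
      rw [pow_succ, AlgHom.mul_apply, ih, FiniteField.coe_frobeniusAlgHom, ← pow_mul, pow_succ']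
  intro i j hij
  have h := (FiniteField.bijective_frobeniusAlgHom_pow F (AdjoinRoot f.1)).1
    (a₁ := ⟨i, by rw [finrank_adjoinRoot]; exact i.2⟩)
    (a₂ := ⟨j, by rw [finrank_adjoinRoot]; exact j.2⟩) (by
      refine AdjoinRoot.algHom_ext ?_
      simpa only [hpow] using hij)
  exact Fin.ext (by simpa using h)

/-- Since `f(X ^ q) = f(X) ^ q`, all `d` distinct Frobenius conjugates of the root are roots of `f`.
-/
theorem prod_X_sub_C_root_pow :
    ∏ j : Fin f.1.natDegree, (X - C (AdjoinRoot.root f.1 ^ Fintype.card F ^ (j : ℕ))) =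
      f.1.map (algebraMap F (AdjoinRoot f.1)) := by
  symm
  refine eq_of_monic_of_dvd_of_natDegree_le (monic_prod_X_sub_C _ _) (f.2.1.map _) ?_ ?_
  · refine Finset.prod_dvd_of_coprime (fun i _ j _ hij => ?_) fun j _ => ?_
    · exact pairwise_coprime_X_sub_C (root_pow_card_pow_injective f) hij
    · rw [dvd_iff_isRoot, IsRoot, eval_map_algebraMap]
      have h : aeval (AdjoinRoot.root f.1) (expand F (Fintype.card F ^ (j : ℕ)) f.1) = 0 := by
        have e : expand F (Fintype.card F ^ (j : ℕ)) f.1 = f.1 ^ Fintype.card F ^ (j : ℕ) := by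
          induction (j : ℕ) with
          | zero => simp
          | succ m ih =>
            rw [pow_succ, mul_comm, expand_mul, ih, map_pow, FiniteField.expand_card, ← pow_mul]
        rw [e, map_pow, AdjoinRoot.aeval_eq, AdjoinRoot.mk_self,
          zero_pow (pow_pos Fintype.card_pos _).ne']
      rwa [expand_aeval] at h
  · rw [natDegree_map, natDegree_prod_of_monic _ _ fun _ _ => monic_X_sub_C _]
    simp only [natDegree_X_sub_C, Finset.sum_const, Finset.card_univ, Fintype.card_fin, smul_eq_mul,
      mul_one, le_refl]

theorem exists_localPoly : ∃ Q : F[X][X], Q.map (mapRingHom (algebraMap F (AdjoinRoot f.1))) =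
    twistPoly (Fintype.card F) f.1.natDegree φ.rank (redCoeff φ f) :=
  exists_map_eq_twistPoly (natDegree_pos f) (pow_card_pow f) _ _

/-- The determinant of `T - φ_θ` modulo `f` as a polynomial in `x = τ ^ d` over `𝔽_q[T]`. -/
def localPoly : F[X][X] := (exists_localPoly φ f).choose

theorem map_localPoly : (localPoly φ f).map (mapRingHom (algebraMap F (AdjoinRoot f.1))) =
    twistPoly (Fintype.card F) f.1.natDegree φ.rank (redCoeff φ f) :=
  (exists_localPoly φ f).choose_spec

theorem map_localPoly_redRank :
    (localPoly φ f).map (mapRingHom (algebraMap F (AdjoinRoot f.1))) =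
      twistPoly (Fintype.card F) f.1.natDegree (redRank φ f) (redCoeff φ f) := by
  rw [map_localPoly, twistPoly, twistPoly, twistDet, twistDet,
    twistMatrix_eq_of_le _ _ (redRank_le φ f) Fintype.card_pos]
  intro i hi
  rw [redCoeff_of_gt φ f hi, C_0, C_0]

theorem map_coeff_localPoly (i : ℕ) :
    ((localPoly φ f).coeff i).map (algebraMap F (AdjoinRoot f.1)) =
      (twistPoly (Fintype.card F) f.1.natDegree φ.rank (redCoeff φ f)).coeff i := by
  rw [← map_localPoly, coeff_map, coe_mapRingHom]

theorem map_coeff_localPoly_redRank (i : ℕ) :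
    ((localPoly φ f).coeff i).map (algebraMap F (AdjoinRoot f.1)) =
      (twistPoly (Fintype.card F) f.1.natDegree (redRank φ f) (redCoeff φ f)).coeff i := by
  rw [← map_localPoly_redRank, coeff_map, coe_mapRingHom]

theorem localPoly_coeff_zero : (localPoly φ f).coeff 0 = f.1 := by
  apply map_adjoinRoot_injective f
  rw [map_coeff_localPoly, coeff_zero_twistPoly (natDegree_pos f), redCoeff_zero,
    prod_X_sub_C_root_pow]

/-- The coefficients of the characteristic polynomial of the Frobenius satisfy the Riemann
hypothesis. -/
theorem weight_coeff_localPoly_le {i : ℕ} (hi : (localPoly φ f).coeff i ≠ 0) :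
    φ.rank * ((localPoly φ f).coeff i).natDegree + f.1.natDegree * i ≤
      φ.rank * f.1.natDegree := by
  have h := weight_coeff_twistPoly_le (natDegree_pos f) φ.rank_pos (Fintype.card F)
    (redCoeff φ f) (i := i) (by
      rwa [← map_coeff_localPoly, Ne, Polynomial.map_eq_zero])
  rwa [← map_coeff_localPoly, natDegree_map] at h

theorem natDegree_localPoly_le : (localPoly φ f).natDegree ≤ redRank φ f := by
  have h := natDegree_twistPoly_le (natDegree_pos f) (Fintype.card F) (redRank φ f) (redCoeff φ f)
  rwa [← map_localPoly_redRank, natDegree_map_eq_of_injective] at h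
  exact map_adjoinRoot_injective f

theorem coeff_localPoly_redRank (h : 0 < redRank φ f) :
    ∃ a : F, a ≠ 0 ∧ (localPoly φ f).coeff (redRank φ f) = C a := by
  obtain ⟨b, hb, e⟩ := coeff_twistPoly_rank (q := Fintype.card F) (natDegree_pos f) h
    (redCoeff_redRank φ f h)
  rw [← map_coeff_localPoly_redRank] at e
  have hdeg : ((localPoly φ f).coeff (redRank φ f)).natDegree = 0 := by
    rw [← natDegree_map (algebraMap F (AdjoinRoot f.1)), e, natDegree_C]
  obtain ⟨a, ha⟩ := natDegree_eq_zero.mp hdeg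
  refine ⟨a, ?_, ha.symm⟩
  rintro rfl
  rw [← ha, C_0, Polynomial.map_zero] at e
  exact hb (C_eq_zero.mp e.symm)

theorem natDegree_localPoly : (localPoly φ f).natDegree = redRank φ f := by
  refine (natDegree_localPoly_le φ f).antisymm ?_
  rcases Nat.eq_zero_or_pos (redRank φ f) with h | h
  · omega
  · obtain ⟨a, ha, e⟩ := coeff_localPoly_redRank φ f h
    exact le_natDegree_of_ne_zero (by rw [e]; exact C_ne_zero.mpr ha)

end Local

/-! ### Freeness of Tate modules -/

section TateFree

variable {R N : Type*} [CommRing R] [AddCommGroup N] [Module R N] {h : R}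

theorem tateModule_pow_smul_apply (x : tateModule N h) (m k : ℕ) : h ^ m • x.1 (k + m) = x.1 k := by
  induction m with
  | zero => simp
  | succ m ih => rw [pow_succ, mul_smul, ← add_assoc, x.2.2, ih]

/-- Every element of `N[h]` extends to an element of the Tate module if `N` is `h`-divisible. -/
theorem exists_tateModule_apply_one (hdiv : ∀ x : N, ∃ y, h • y = x) {x : N} (hx : h • x = 0) :
    ∃ y : tateModule N h, y.1 1 = x := by
  choose s hs using hdiv
  -- Component `k + 1` is `x` divided `k` times by `h`; component `0` must be `0`, which is
  -- consistent because `h • x = 0`.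
  refine ⟨⟨fun k => Nat.rec 0 (fun k _ => s^[k] x) k, rfl, fun k => ?_⟩, rfl⟩
  cases k with
  | zero => exact hx
  | succ k =>
    change h • s^[k + 1] x = s^[k] x
    rw [Function.iterate_succ_apply', hs]

variable {r : ℕ} {e : Fin r → tateModule N h}

/-- Dévissage along `N[h ^ k] ⊆ N[h ^ (k + 1)]`: multiplication by `h ^ k` sends level `k + 1` to
level `1`, where generation is known. -/
theorem exists_sum_smul_level (hgen : ∀ x : N, h • x = 0 → ∃ a : Fin r → R, ∑ l, a l • (e l).1 1 = x)
    (k : ℕ) {x : N} (hx : h ^ k • x = 0) : ∃ a : Fin r → R, ∑ l, a l • (e l).1 k = x := by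
  induction k generalizing x with
  | zero => exact ⟨0, by simpa using hx.symm⟩
  | succ k ih =>
    obtain ⟨a, ha⟩ := hgen (h ^ k • x) (by rw [← mul_smul, ← pow_succ', hx])
    obtain ⟨b, hb⟩ := ih (x := x - ∑ l, a l • (e l).1 (k + 1)) (by
      rw [smul_sub, Finset.smul_sum, sub_eq_zero, ← ha]
      refine Finset.sum_congr rfl fun l _ => ?_
      rw [smul_comm, add_comm k 1, tateModule_pow_smul_apply])
    refine ⟨fun l => a l + h * b l, ?_⟩
    simp only [add_smul, Finset.sum_add_distrib, mul_comm h, mul_smul, (e _).2.2, hb]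
    abel

theorem pow_dvd_of_sum_smul_level
    (hind : ∀ a : Fin r → R, ∑ l, a l • (e l).1 1 = 0 → ∀ l, h ∣ a l)
    (k : ℕ) {a : Fin r → R} (ha : ∑ l, a l • (e l).1 k = 0) (l : Fin r) : h ^ k ∣ a l := by
  induction k generalizing a with
  | zero => simp
  | succ k ih =>
    have h1 : ∀ l, h ∣ a l := hind a (by
      have := congrArg (fun y => h ^ k • y) ha
      simp only [Finset.smul_sum, smul_zero, smul_comm (h ^ k), add_comm k 1,
        tateModule_pow_smul_apply] at this
      exact this)
    choose b hb using h1
    rw [hb l, pow_succ']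
    refine mul_dvd_mul_left _ (ih ?_)
    rw [← ha]
    refine Finset.sum_congr rfl fun l _ => ?_
    rw [hb l, mul_comm, mul_smul, (e l).2.2]

theorem adic_sum_smul_apply (α : Fin r → AdicCompletion (Ideal.span {h}) R) (k : ℕ)
    {a : Fin r → R} (ha : ∀ l, Ideal.Quotient.mk _ (a l) = (α l).1 k) :
    (∑ l, α l • e l).1 k = ∑ l, a l • (e l).1 k := by
  rw [AddSubmonoidClass.coe_finsetSum, Finset.sum_apply]
  exact Finset.sum_congr rfl fun l _ => adic_smul_apply_of_mk (ha l) _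

theorem mem_span_pow_smul_top {k : ℕ} {a : R} :
    a ∈ (Ideal.span {h} ^ k • ⊤ : Ideal R) ↔ h ^ k ∣ a := by
  rw [smul_eq_mul, Ideal.mul_top, Ideal.span_singleton_pow, Ideal.mem_span_singleton]

/-- Any compatible lifts of an `R / h`-basis of `N[h]` work. At level `k` coordinates exist and are
unique modulo `h ^ k`, so they glue to elements of the completion. -/
theorem exists_tateModule_basis
    (hgen : ∀ x : N, h • x = 0 → ∃ a : Fin r → R, ∑ l, a l • (e l).1 1 = x)
    (hind : ∀ a : Fin r → R, ∑ l, a l • (e l).1 1 = 0 → ∀ l, h ∣ a l) :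
    ∃ b : Module.Basis (Fin r) (AdicCompletion (Ideal.span {h}) R) (tateModule N h),
      ∀ l, b l = e l := by
  have hli : LinearIndependent (AdicCompletion (Ideal.span {h}) R) e := by
    rw [Fintype.linearIndependent_iff]
    intro α hα l
    refine AdicCompletion.ext fun k => ?_
    choose a ha using fun l => Ideal.Quotient.mk_surjective ((α l).1 k)
    have h0 : ∑ l, a l • (e l).1 k = 0 := by
      rw [← adic_sum_smul_apply α k ha, hα]
      rfl
    rw [← ha l]
    exact Ideal.Quotient.eq_zero_iff_mem.mpr
      (mem_span_pow_smul_top.mpr (pow_dvd_of_sum_smul_level hind k h0 l))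
  have hsp : ⊤ ≤ Submodule.span (AdicCompletion (Ideal.span {h}) R) (Set.range e) := by
    intro x _
    choose a ha using fun k => exists_sum_smul_level hgen k (tateModule_pow_smul x k)
    have hcompat : ∀ l {m n : ℕ}, m ≤ n → a n l - a m l ∈ (Ideal.span {h} ^ m • ⊤ : Ideal R) := by
      intro l m n hmn
      rw [mem_span_pow_smul_top]
      obtain ⟨i, rfl⟩ := Nat.exists_eq_add_of_le hmn
      refine pow_dvd_of_sum_smul_level (a := fun l => a (m + i) l - a m l) hind m ?_ l
      simp only [sub_smul, Finset.sum_sub_distrib]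
      rw [ha, ← tateModule_pow_smul_apply x i, ← ha, Finset.smul_sum, sub_eq_zero]
      refine Finset.sum_congr rfl fun l _ => ?_
      rw [smul_comm, tateModule_pow_smul_apply]
    let α : Fin r → AdicCompletion (Ideal.span {h}) R := fun l =>
      ⟨fun k => Ideal.Quotient.mk _ (a k l), fun {m n} hmn =>
        (Ideal.Quotient.mk_eq_mk_iff_sub_mem _ _).mpr (hcompat l hmn)⟩
    have hx : x = ∑ l, α l • e l := by
      refine Subtype.ext (funext fun k => ?_)
      rw [adic_sum_smul_apply (e := e) α k (a := a k) fun l => rfl, ha]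
    rw [hx]
    exact Submodule.sum_mem _ fun l _ =>
      Submodule.smul_mem _ _ (Submodule.subset_span (Set.mem_range_self l))
  exact ⟨Module.Basis.mk hli hsp, fun l => by simp⟩

/-- The characteristic polynomial on the Tate module can be computed on all `N[h ^ k]`. -/
theorem exists_tateModule_basis_charpoly (hdiv : ∀ x : N, ∃ y, h • y = x) {e₁ : Fin r → N}
    (he : ∀ l, h • e₁ l = 0)
    (hgen : ∀ x : N, h • x = 0 → ∃ a : Fin r → R, ∑ l, a l • e₁ l = x)
    (hind : ∀ a : Fin r → R, ∑ l, a l • e₁ l = 0 → ∀ l, h ∣ a l) (u : N →ₗ[R] N) (P : R[X])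
    (hlevel : ∀ (k : ℕ) (E : Fin r → N) (G : Matrix (Fin r) (Fin r) R),
      (∀ l, h ^ k • E l = 0) →
      (∀ x : N, h ^ k • x = 0 → ∃ a : Fin r → R, ∑ l, a l • E l = x) →
      (∀ a : Fin r → R, ∑ l, a l • E l = 0 → ∀ l, h ^ k ∣ a l) →
      (∀ j, u (E j) = ∑ i, G i j • E i) → ∀ n, h ^ k ∣ (G.charpoly - P).coeff n) :
    ∃ b : Module.Basis (Fin r) (AdicCompletion (Ideal.span {h}) R) (tateModule N h),
      (LinearMap.toMatrix b b (tateMap h u)).charpoly =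
        P.map (algebraMap R (AdicCompletion (Ideal.span {h}) R)) := by
  choose e he' using fun l => exists_tateModule_apply_one hdiv (he l)
  simp only [← he'] at hgen hind
  obtain ⟨b, hb⟩ := exists_tateModule_basis hgen hind
  refine ⟨b, ?_⟩
  ext1 n
  -- It suffices to compare coefficients modulo each `h ^ k`, where the matrix on the Tate module
  -- reduces to a matrix `G` of `u` on the level `N[h ^ k]`.
  refine AdicCompletion.ext_evalₐ fun k => ?_
  choose G hG using fun i j => Ideal.Quotient.mk_surjective
    ((LinearMap.toMatrix b b (tateMap h u) i j).1 k)
  have hu : ∀ j, u ((e j).1 k) = ∑ i, G i j • (e i).1 k := by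
    intro j
    have h1 : tateMap h u (e j) = ∑ i, LinearMap.toMatrix b b (tateMap h u) i j • e i := by
      conv_lhs => rw [← hb j, ← b.sum_repr (tateMap h u (b j))]
      simp [LinearMap.toMatrix_apply, hb]
    have h2 := congrArg (fun y => y.1 k) h1
    exact h2.trans (adic_sum_smul_apply _ k fun i => hG i j)
  have hl := hlevel k (fun l => (e l).1 k) (Matrix.of G) (fun l => tateModule_pow_smul _ _)
    (fun x => exists_sum_smul_level hgen k) (fun a => pow_dvd_of_sum_smul_level hind k) hu n
  have hM : (AdicCompletion.evalₐ (Ideal.span {h}) k : _ →+* _).mapMatrix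
      (LinearMap.toMatrix b b (tateMap h u)) =
      (Ideal.Quotient.mk (Ideal.span {h} ^ k)).mapMatrix (Matrix.of G) := by
    ext1 i j
    simp only [RingHom.mapMatrix_apply, Matrix.map_apply, Matrix.of_apply, RingHom.coe_coe]
    rw [← AdicCompletion.factor_eval_eq_evalₐ _ _ (le_of_eq (Ideal.mul_top _)),
      AdicCompletion.eval_apply, ← hG i j]
    rfl
  have h3 := congrArg Matrix.charpoly hM
  rw [RingHom.mapMatrix_apply, RingHom.mapMatrix_apply, Matrix.charpoly_map,
    Matrix.charpoly_map] at h3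
  replace h3 := congrArg (fun p => p.coeff n) h3
  simp only [coeff_map, RingHom.coe_coe] at h3
  rw [h3, coeff_map]
  have h4 : AdicCompletion.evalₐ (Ideal.span {h}) k (algebraMap R _ (P.coeff n)) =
    Ideal.Quotient.mk _ (P.coeff n) := AlgHom.commutes _ _
  rw [h4, Ideal.Quotient.mk_eq_mk_iff_sub_mem, ← coeff_sub, Ideal.span_singleton_pow,
    Ideal.mem_span_singleton]
  exact hl

end TateFree

/-! ### Torsion of the reduction of `φ` -/

/-- Over a finite field the cardinality of a finite module determines its dimension. -/
theorem exists_basis_of_isField {R V : Type*} [CommRing R] (hR : IsField R) [AddCommGroup V]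
    [Module R V] [Finite V] {n : ℕ} (hcard : 1 < Nat.card R) (hV : Nat.card V = Nat.card R ^ n) :
    Nonempty (Module.Basis (Fin n) R V) := by
  let _ : Field R := hR.toField
  have : Module.Finite R V := Module.Finite.of_finite
  refine ⟨Module.finBasisOfFinrankEq R V ?_⟩
  rw [Module.natCard_eq_pow_finrank (K := R)] at hV
  exact Nat.pow_right_injective hcard hV

/-! ### The operator `g(φ_θ)` as a polynomial -/

section IteratedComp

variable {F L : Type*} [Field F] [Field L] [Algebra F L]

/-- The polynomial `∑ g_n P ∘ ⋯ ∘ P` (`n`-fold composition). -/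
def compSum (P : L[X]) (g : F[X]) : L[X] :=
  ∑ n ∈ Finset.range (g.natDegree + 1), C (algebraMap F L (g.coeff n)) * P.comp^[n] X

theorem eval_compSum {P : L[X]} {u : Module.End F L} (hP : ∀ x, P.eval x = u x) (g : F[X]) (x : L) :
    (compSum P g).eval x = aeval u g x := by
  rw [aeval_eq_sum_range, compSum, eval_finsetSum, LinearMap.sum_apply]
  refine Finset.sum_congr rfl fun n _ => ?_
  rw [eval_mul, eval_C, iterate_comp_eval, eval_X, LinearMap.smul_apply, Algebra.smul_def,
    Module.End.pow_apply]
  simp only [hP]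

theorem derivative_iterate_comp {P : L[X]} {a : L} (hP : derivative P = C a) (n : ℕ) :
    derivative (P.comp^[n] X) = C (a ^ n) := by
  induction n with
  | zero => simp
  | succ n ih =>
    rw [Function.iterate_succ_apply', derivative_comp, hP, ih, C_comp, ← C_mul, pow_succ]

/-- An additive polynomial has constant derivative and the chain rule multiplies these constants, so
differentiating `g(φ_θ)` replaces `φ_θ` by its constant coefficient. This will give separability
away from `f`. -/
theorem derivative_compSum {P : L[X]} {a : L} (hP : derivative P = C a) (g : F[X]) :
    derivative (compSum P g) = C (aeval a g) := by
  rw [compSum, derivative_sum, aeval_eq_sum_range, map_sum]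
  refine Finset.sum_congr rfl fun n _ => ?_
  rw [derivative_C_mul, derivative_iterate_comp hP, ← C_mul, Algebra.smul_def]

theorem natDegree_compSum {P : L[X]} (hP : 1 < P.natDegree) {g : F[X]} (hg : g ≠ 0) :
    (compSum P g).natDegree = P.natDegree ^ g.natDegree := by
  have hn : ∀ n, (P.comp^[n] X).natDegree = P.natDegree ^ n := fun n => by
    rw [natDegree_iterate_comp, natDegree_X, mul_one]
  have htop : (C (algebraMap F L (g.coeff g.natDegree)) * P.comp^[g.natDegree] X).natDegree =
      P.natDegree ^ g.natDegree := by
    rw [natDegree_C_mul, hn]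
    simpa using hg
  rw [compSum, Finset.sum_range_succ, natDegree_add_eq_right_of_natDegree_lt, htop]
  rw [htop]
  rcases Nat.eq_zero_or_pos g.natDegree with h0 | h0
  · rw [h0]; simp
  · refine lt_of_le_of_lt (natDegree_sum_le_of_forall_le (n := P.natDegree ^ (g.natDegree - 1)) _ _
      fun n hmem => ?_) (Nat.pow_lt_pow_right hP (by omega))
    refine (natDegree_C_mul_le _ _).trans ?_
    rw [hn]
    have := Finset.mem_range.mp hmem
    exact Nat.pow_le_pow_right (by omega) (by omega)

end IteratedComp

/-! ### Counting torsion points away from `f` -/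

section Torsion

variable {F : Type*} [Field F] (φ : DrinfeldModule F) (f : MonicIrred F)

/-- The coefficients of the reduction of `φ_θ` in the algebraic closure of `A / f A`. -/
def resCoeff (i : ℕ) : ResClosure f := algebraMap (AdjoinRoot f.1) (ResClosure f) (redCoeff φ f i)

theorem aeval_resCoeff_zero (g : F[X]) : aeval (resCoeff φ f 0) g =
    algebraMap (AdjoinRoot f.1) (ResClosure f) (AdjoinRoot.mk f.1 g) := by
  rw [resCoeff, aeval_algebraMap_apply, redCoeff_zero, AdjoinRoot.aeval_eq]

theorem not_dvd_of_ne {h : MonicIrred F} (hne : h ≠ f) : ¬ f.1 ∣ h.1 := fun hdvd =>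
  hne (Subtype.ext (eq_of_monic_of_associated h.2.1 f.2.1
    ((f.2.2.associated_of_dvd h.2.2 hdvd).symm)))

variable {f} in
theorem aeval_resCoeff_zero_ne_zero {g : F[X]} (hg : ¬ f.1 ∣ g) :
    aeval (resCoeff φ f 0) g ≠ 0 := by
  rw [aeval_resCoeff_zero]
  exact (_root_.map_ne_zero _).mpr fun h => hg (AdjoinRoot.mk_eq_zero.mp h)

variable [Fintype F]

theorem redOp_apply (x : ResClosure f) :
    redOp φ f x = ∑ i ∈ Finset.range (φ.rank + 1), resCoeff φ f i * x ^ Fintype.card F ^ i := by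
  simp only [redOp, skewOp, LinearMap.sum_apply, Module.End.mul_apply, LinearMap.mulLeft_apply,
    resFrob_pow_apply]
  rfl

theorem redOp_apply_redRank (x : ResClosure f) :
    redOp φ f x = ∑ i ∈ Finset.range (redRank φ f + 1), resCoeff φ f i * x ^ Fintype.card F ^ i := by
  rw [redOp_apply]
  symm
  refine Finset.sum_subset (Finset.range_mono (by have := redRank_le φ f; omega)) fun i _ hi => ?_
  rw [resCoeff, redCoeff_of_gt φ f (by simpa using hi), map_zero, zero_mul]

/-- The polynomial `∑ φ_{θ,i} X ^ (q ^ i)` modulo `f`. -/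
def addPoly : (ResClosure f)[X] :=
  ∑ i ∈ Finset.range (redRank φ f + 1), C (resCoeff φ f i) * X ^ Fintype.card F ^ i

theorem eval_addPoly (x : ResClosure f) : (addPoly φ f).eval x = redOp φ f x := by
  rw [redOp_apply_redRank, addPoly, eval_finsetSum]
  simp

theorem natCast_card_eq_zero : ((Fintype.card F : ℕ) : ResClosure f) = 0 := by
  rw [← map_natCast (algebraMap F (ResClosure f)), FiniteField.cast_card_eq_zero, map_zero]

theorem derivative_addPoly : derivative (addPoly φ f) = C (resCoeff φ f 0) := by
  rw [addPoly, derivative_sum, Finset.sum_range_succ', Finset.sum_eq_zero]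
  · simp
  · intro i _
    rw [derivative_C_mul, derivative_X_pow, pow_succ, Nat.cast_mul, natCast_card_eq_zero]
    simp

theorem natDegree_addPoly (h : 0 < redRank φ f) :
    (addPoly φ f).natDegree = Fintype.card F ^ redRank φ f := by
  have htop : (C (resCoeff φ f (redRank φ f)) *
      X ^ Fintype.card F ^ redRank φ f : (ResClosure f)[X]).natDegree =
      Fintype.card F ^ redRank φ f := by
    rw [natDegree_C_mul_X_pow]
    exact (_root_.map_ne_zero _).mpr (redCoeff_redRank φ f h)
  rw [addPoly, Finset.sum_range_succ, natDegree_add_eq_right_of_natDegree_lt, htop]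
  rw [htop]
  refine lt_of_le_of_lt (natDegree_sum_le_of_forall_le (n := Fintype.card F ^ (redRank φ f - 1)) _ _
    fun n hmem => ?_) (Nat.pow_lt_pow_right Fintype.one_lt_card (by omega))
  refine (natDegree_C_mul_X_pow_le _ _).trans ?_
  have := Finset.mem_range.mp hmem
  exact Nat.pow_le_pow_right Fintype.card_pos (by omega)

variable {f} in
theorem natDegree_torsion {g : F[X]} (hg : ¬ f.1 ∣ g) :
    (compSum (addPoly φ f) g).natDegree = Fintype.card F ^ (redRank φ f * g.natDegree) := by
  rcases Nat.eq_zero_or_pos (redRank φ f) with h | h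
  · have h1 : compSum (addPoly φ f) g = C (aeval (resCoeff φ f 0) g) * X := by
      have h2 : addPoly φ f = C (resCoeff φ f 0) * X := by simp [addPoly, h]
      have h3 : ∀ n, (addPoly φ f).comp^[n] X = C (resCoeff φ f 0 ^ n) * X := by
        intro n
        induction n with
        | zero => simp
        | succ n ih =>
          rw [Function.iterate_succ_apply', ih, h2]
          simp [pow_succ', mul_assoc]
      rw [compSum, aeval_eq_sum_range, map_sum, Finset.sum_mul]
      refine Finset.sum_congr rfl fun n _ => ?_
      rw [h3, ← mul_assoc, ← C_mul, Algebra.smul_def]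
    rw [h1, h, zero_mul, pow_zero, natDegree_C_mul_X _ (aeval_resCoeff_zero_ne_zero φ hg)]
  · rw [natDegree_compSum, natDegree_addPoly φ f h, pow_mul]
    · rw [natDegree_addPoly φ f h]
      exact Nat.one_lt_pow h.ne' Fintype.one_lt_card
    · rintro rfl
      exact hg (dvd_zero _)

variable {f} in
theorem separable_torsion {g : F[X]} (hg : ¬ f.1 ∣ g) : (compSum (addPoly φ f) g).Separable := by
  rw [Polynomial.Separable, derivative_compSum (derivative_addPoly φ f)]
  exact isCoprime_one_right.of_isCoprime_of_dvd_right
    (isUnit_C.mpr (aeval_resCoeff_zero_ne_zero φ hg).isUnit).dvd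

variable {f} in
theorem card_torsion {g : F[X]} (hg : ¬ f.1 ∣ g) :
    Nat.card {x : ResClosure f // aeval (redOp φ f) g x = 0} =
      Fintype.card F ^ (redRank φ f * g.natDegree) := by
  have hsep := separable_torsion φ hg
  rw [← natDegree_torsion φ hg, ← card_rootSet_eq_natDegree (K := ResClosure f) hsep
    (IsAlgClosed.splits _), ← Nat.card_eq_fintype_card]
  refine Nat.card_congr (Equiv.subtypeEquivRight fun x => ?_)
  rw [mem_rootSet_of_ne hsep.ne_zero, ← eval_compSum (eval_addPoly φ f), coe_aeval_eq_eval]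

variable {f} in
-- Solving `g • y = x` means finding a root of a nonconstant polynomial over an algebraically closed
-- field.
theorem smul_surjective {g : F[X]} (hg : ¬ f.1 ∣ g) (x : RedModule φ f) : ∃ y, g • y = x := by
  have hdeg : (compSum (addPoly φ f) g - C ((Module.AEval'.of (redOp φ f)).symm x)).degree ≠ 0 := by
    intro h0
    have h1 := natDegree_eq_of_degree_eq_some (n := 0) h0
    rw [natDegree_sub_C, natDegree_torsion φ hg] at h1
    exact (pow_pos Fintype.card_pos _).ne' h1
  obtain ⟨y, hy⟩ := IsAlgClosed.exists_root _ hdeg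
  refine ⟨Module.AEval'.of (redOp φ f) y, ?_⟩
  rw [IsRoot, eval_sub, eval_C, sub_eq_zero, eval_compSum (eval_addPoly φ f)] at hy
  rw [← Module.AEval.of_aeval_smul]
  exact (LinearEquiv.eq_symm_apply _).mp hy

variable {f} in
/-- The `h`-torsion of the reduction of `φ` is free of rank `r₀` over `A / h A`. -/
theorem exists_torsion_basis {h : MonicIrred F} (hne : h ≠ f) :
    ∃ e : Fin (redRank φ f) → RedModule φ f, (∀ l, h.1 • e l = 0) ∧
      (∀ x : RedModule φ f, h.1 • x = 0 → ∃ a : Fin (redRank φ f) → F[X], ∑ l, a l • e l = x) ∧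
      (∀ a : Fin (redRank φ f) → F[X], ∑ l, a l • e l = 0 → ∀ l, h.1 ∣ a l) := by
  let V := Submodule.torsionBy F[X] (RedModule φ f) h.1
  have hfield : IsField (F[X] ⧸ Ideal.span {h.1}) :=
    (Ideal.Quotient.maximal_ideal_iff_isField_quotient _).mp
      (PrincipalIdealRing.isMaximal_of_irreducible h.2.2)
  have hV : Nat.card V = Fintype.card F ^ (redRank φ f * h.1.natDegree) :=
    card_torsion φ (not_dvd_of_ne f hne)
  have hcard : Nat.card (F[X] ⧸ Ideal.span {h.1}) = Fintype.card F ^ h.1.natDegree := by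
    have : Module.Finite F (AdjoinRoot h.1) := h.2.1.finite_adjoinRoot
    have := Module.natCard_eq_pow_finrank (K := F) (V := AdjoinRoot h.1)
    rw [finrank_adjoinRoot, Nat.card_eq_fintype_card (α := F)] at this
    exact this
  have hfin : Finite V := Nat.finite_of_card_ne_zero (by
    rw [hV]; exact (pow_pos Fintype.card_pos _).ne')
  obtain ⟨b⟩ := exists_basis_of_isField (V := V) (n := redRank φ f) hfield
    (by rw [hcard]; exact Nat.one_lt_pow (natDegree_pos h).ne' Fintype.one_lt_card)
    (by rw [hV, hcard, ← pow_mul, mul_comm])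
  refine ⟨fun l => (b l).1, fun l => (b l).2, fun x hx => ?_, fun a ha l => ?_⟩
  · choose a ha using fun l => Ideal.Quotient.mk_surjective (b.repr ⟨x, hx⟩ l)
    refine ⟨a, ?_⟩
    have h1 := b.sum_repr ⟨x, hx⟩
    simp only [← ha] at h1
    have h2 := congrArg (fun y : V => (y : RedModule φ f)) h1
    simpa using h2
  · have h1 : ∑ l, (Ideal.Quotient.mk (Ideal.span {h.1}) (a l)) • b l = 0 := by
      refine Subtype.ext ?_
      simpa using ha
    have h2 := Fintype.linearIndependent_iff.mp b.linearIndependent _ h1 l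
    rwa [Ideal.Quotient.eq_zero_iff_mem, Ideal.mem_span_singleton] at h2

end Torsion

/-! ### Anderson generating functions and the characteristic polynomial of the Frobenius -/

section Anderson

variable {F : Type*} [Field F] (φ : DrinfeldModule F) (f : MonicIrred F) (g : F[X])

/-- The ring `k[T] / g`, where `k` is the algebraic closure of `A / f A`. -/
abbrev LevelRing := AdjoinRoot (g.map (algebraMap F (ResClosure f)))

/-- The class of `T` in `k[T] / g`. -/
abbrev levelT : LevelRing f g := AdjoinRoot.root _

/-- The inclusion of the constants in `k[T] / g`. -/
abbrev levelC : ResClosure f →+* LevelRing f g := AdjoinRoot.of _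

theorem aeval_levelT_self : aeval (levelT f g) g = 0 := by
  have h := AdjoinRoot.eval₂_root (g.map (algebraMap F (ResClosure f)))
  rwa [eval₂_map] at h

variable {g} in
/-- The coefficient of `T ^ (deg g - 1)` of an element of `k[T] / g`. -/
def topCoeff (hg : g.Monic) : LevelRing f g →ₗ[ResClosure f] ResClosure f :=
  lcoeff (ResClosure f) (g.natDegree - 1) ∘ₗ
    AdjoinRoot.modByMonicHom (hg.map (algebraMap F (ResClosure f)))

variable {g} in
theorem topCoeff_mul_pow (hg : g.Monic) (c : ResClosure f) {j : ℕ} (hj : j < g.natDegree) :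
    topCoeff f hg (levelC f g c * levelT f g ^ j) = if j = g.natDegree - 1 then c else 0 := by
  have h1 : levelC f g c * levelT f g ^ j = AdjoinRoot.mk _ (C c * X ^ j) := by
    rw [map_mul, map_pow, AdjoinRoot.mk_X, AdjoinRoot.mk_C]
  rw [h1, topCoeff, LinearMap.comp_apply, AdjoinRoot.modByMonicHom_mk, lcoeff_apply,
    (modByMonic_eq_self_iff (hg.map _)).mpr, coeff_C_mul, coeff_X_pow]
  · simp [eq_comm]
  · refine lt_of_le_of_lt (degree_C_mul_X_pow_le _ _) ?_
    rw [degree_map, degree_eq_natDegree hg.ne_zero]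
    exact_mod_cast hj

variable [Fintype F]

/-- The Frobenius `c ↦ c ^ q` on the coefficients of elements of `k[T] / g`. -/
def levelFrob : LevelRing f g →+* LevelRing f g :=
  AdjoinRoot.lift ((levelC f g).comp (resFrob f : ResClosure f →+* ResClosure f)) (levelT f g) (by
    rw [eval₂_map, RingHom.comp_assoc,
      show (resFrob f : ResClosure f →+* ResClosure f).comp (algebraMap F (ResClosure f)) =
        algebraMap F (ResClosure f) from (resFrob f).comp_algebraMap, ← eval₂_map]
    exact AdjoinRoot.eval₂_root _)

theorem levelFrob_pow_levelC (j : ℕ) (c : ResClosure f) :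
    (levelFrob f g ^ j) (levelC f g c) = levelC f g (c ^ Fintype.card F ^ j) := by
  induction j with
  | zero => simp
  | succ j ih =>
    rw [pow_succ', RingHom.mul_def, RingHom.comp_apply, ih, levelFrob, AdjoinRoot.lift_of]
    simp only [RingHom.comp_apply, RingHom.coe_coe, FiniteField.coe_frobeniusAlgHom, ← pow_mul,
      pow_succ]

theorem levelFrob_pow_aeval (j : ℕ) (a : F[X]) :
    (levelFrob f g ^ j) (aeval (levelT f g) a) = aeval (levelT f g) a := by
  have hT : (levelFrob f g ^ j) (levelT f g) = levelT f g := by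
    induction j with
    | zero => simp
    | succ j ih =>
      rw [pow_succ', RingHom.mul_def, RingHom.comp_apply, ih, levelFrob, AdjoinRoot.lift_root]
  have hc : ∀ b : F, (levelFrob f g ^ j) (algebraMap F (LevelRing f g) b) =
      algebraMap F (LevelRing f g) b := by
    intro b
    rw [show algebraMap F (LevelRing f g) b = levelC f g (algebraMap F _ b) from rfl,
      levelFrob_pow_levelC, ← map_pow, FiniteField.pow_card_pow]
  rw [aeval_def, hom_eval₂, hT]
  congr 1
  exact RingHom.ext hc

theorem levelFrob_pow_levelT (j : ℕ) : (levelFrob f g ^ j) (levelT f g) = levelT f g := by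
  simpa using levelFrob_pow_aeval f g j X

/-- The Anderson generating function
`(g(φ_θ) - g(T)) / (φ_θ - T)` applied to `x`, modulo `g`. -/
def genFun : ResClosure f →ₗ[F] LevelRing f g :=
  ∑ n ∈ Finset.range (g.natDegree + 1), g.coeff n • ∑ i ∈ Finset.range n,
    LinearMap.mulRight F (levelT f g ^ (n - 1 - i)) ∘ₗ
      (AdjoinRoot.ofAlgHom F (g.map (algebraMap F (ResClosure f)))).toLinearMap ∘ₗ redOp φ f ^ i

theorem genFun_apply (x : ResClosure f) : genFun φ f g x =
    ∑ n ∈ Finset.range (g.natDegree + 1), g.coeff n • ∑ i ∈ Finset.range n,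
      levelC f g ((redOp φ f ^ i) x) * levelT f g ^ (n - 1 - i) := by
  simp [genFun, LinearMap.sum_apply]

/-- The telescoping identity `(φ_θ - T) ∑ φ_θ ^ i T ^ (n - 1 - i) = φ_θ ^ n - T ^ n` gives `g(φ_θ) -
g(T)`. The first term kills `x`, the second vanishes modulo `g`. -/
theorem genFun_redOp {x : ResClosure f} (hx : aeval (redOp φ f) g x = 0) :
    genFun φ f g (redOp φ f x) = levelT f g * genFun φ f g x := by
  have key : ∀ n, ∑ i ∈ Finset.range n,
      levelC f g ((redOp φ f ^ i) (redOp φ f x)) * levelT f g ^ (n - 1 - i) -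
      levelT f g * ∑ i ∈ Finset.range n,
        levelC f g ((redOp φ f ^ i) x) * levelT f g ^ (n - 1 - i) =
      levelC f g ((redOp φ f ^ n) x) - levelC f g x * levelT f g ^ n := by
    intro n
    have h := Finset.sum_range_sub
      (fun i => levelC f g ((redOp φ f ^ i) x) * levelT f g ^ (n - i)) n
    simp only [Nat.sub_self, pow_zero, mul_one, Nat.sub_zero, Module.End.one_apply] at h
    rw [← h, Finset.mul_sum, ← Finset.sum_sub_distrib]
    refine Finset.sum_congr rfl fun i hi => ?_
    have hi' := Finset.mem_range.mp hi
    rw [show n - i = n - 1 - i + 1 by omega, show n - (i + 1) = n - 1 - i by omega,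
      ← Module.End.mul_apply, ← pow_succ]
    ring
  rw [← sub_eq_zero, genFun_apply, genFun_apply, Finset.mul_sum, ← Finset.sum_sub_distrib]
  simp only [mul_smul_comm, ← smul_sub, key]
  have h1 := congrArg (levelC f g) hx
  rw [aeval_eq_sum_range, LinearMap.sum_apply, map_sum, map_zero] at h1
  have h2 := aeval_levelT_self f g
  rw [aeval_eq_sum_range] at h2
  simp only [smul_sub, Finset.sum_sub_distrib]
  have h3 : ∀ (b : F) (y : ResClosure f), levelC f g (b • y) = b • levelC f g y := fun b y =>
    map_smul (AdjoinRoot.ofAlgHom F (g.map (algebraMap F (ResClosure f)))) b y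
  simp only [LinearMap.smul_apply, h3] at h1
  rw [h1, zero_sub, neg_eq_zero]
  simp only [← mul_smul_comm, ← Finset.mul_sum]
  rw [h2, mul_zero]

theorem genFun_aeval {x : ResClosure f} (hx : aeval (redOp φ f) g x = 0) (a : F[X]) :
    genFun φ f g (aeval (redOp φ f) a x) = aeval (levelT f g) a * genFun φ f g x := by
  induction a using Polynomial.induction_on' with
  | add a b ha hb => rw [map_add, LinearMap.add_apply, map_add, ha, hb, map_add, add_mul]
  | monomial n b =>
    induction n with
    | zero =>
      rw [monomial_zero_left, aeval_C, aeval_C, Module.algebraMap_end_apply, map_smul,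
        Algebra.smul_def]
    | succ n ih =>
      rw [← X_mul_monomial, map_mul, Module.End.mul_apply, aeval_X, genFun_redOp, ih, map_mul,
        aeval_X, mul_assoc]
      -- The remaining goal is that the `g`-torsion is stable under `A`.
      rw [← Module.End.mul_apply, ← map_mul, mul_comm, map_mul, Module.End.mul_apply, hx, map_zero]

theorem levelFrob_pow_genFun (j : ℕ) (x : ResClosure f) : (levelFrob f g ^ j) (genFun φ f g x) =
    ∑ n ∈ Finset.range (g.natDegree + 1), g.coeff n • ∑ i ∈ Finset.range n,
      levelC f g (((redOp φ f ^ i) x) ^ Fintype.card F ^ j) * levelT f g ^ (n - 1 - i) := by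
  have hsmul : ∀ (b : F) (s : LevelRing f g),
      (levelFrob f g ^ j) (b • s) = b • (levelFrob f g ^ j) s := by
    intro b s
    have := levelFrob_pow_aeval f g j (C b)
    rw [aeval_C] at this
    rw [Algebra.smul_def, map_mul, this, ← Algebra.smul_def]
  simp only [genFun_apply, map_sum, hsmul, map_mul, map_pow, levelFrob_pow_levelC,
    levelFrob_pow_levelT]

theorem levelFrob_pow_natDegree_genFun (x : ResClosure f) :
    (levelFrob f g ^ f.1.natDegree) (genFun φ f g x) =
      genFun φ f g (x ^ Fintype.card F ^ f.1.natDegree) := by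
  have hcomm : ∀ i, ((redOp φ f ^ i) x) ^ Fintype.card F ^ f.1.natDegree =
      (redOp φ f ^ i) (x ^ Fintype.card F ^ f.1.natDegree) := by
    intro i
    induction i with
    | zero => simp
    | succ i ih =>
      rw [pow_succ', Module.End.mul_apply, Module.End.mul_apply, ← ih, ← resFrob_pow_apply,
        redOp_frob, resFrob_pow_apply]
  rw [levelFrob_pow_genFun, genFun_apply]
  simp only [hcomm]

/-- Expanding `φ_θ` inside the generating function of `φ_θ(x)` gives the Frobenius difference
equation for `ω`; twisting it `j` times gives row `j` of the relation matrix. -/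
theorem levelT_mul_genFun {x : ResClosure f} (hx : aeval (redOp φ f) g x = 0) (j : ℕ) :
    levelT f g * (levelFrob f g ^ j) (genFun φ f g x) =
      ∑ i ∈ Finset.range (φ.rank + 1), levelC f g (resCoeff φ f i) ^ Fintype.card F ^ j *
        (levelFrob f g ^ (j + i)) (genFun φ f g x) := by
  have h0 : levelT f g * genFun φ f g x = ∑ i ∈ Finset.range (φ.rank + 1),
      levelC f g (resCoeff φ f i) * (levelFrob f g ^ i) (genFun φ f g x) := by
    rw [← genFun_redOp φ f g hx]
    simp only [levelFrob_pow_genFun]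
    rw [genFun_apply]
    simp only [Finset.mul_sum, mul_smul_comm]
    rw [Finset.sum_comm]
    refine Finset.sum_congr rfl fun n _ => ?_
    rw [← Finset.smul_sum, Finset.sum_comm]
    congr 1
    refine Finset.sum_congr rfl fun i _ => ?_
    rw [← Module.End.mul_apply, ← pow_succ, pow_succ', Module.End.mul_apply, redOp_apply, map_sum,
      Finset.sum_mul]
    refine Finset.sum_congr rfl fun k _ => ?_
    rw [map_mul, mul_assoc]
  have h1 := congrArg (levelFrob f g ^ j) h0
  rw [map_mul, levelFrob_pow_levelT, map_sum] at h1
  rw [h1]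
  refine Finset.sum_congr rfl fun i _ => ?_
  rw [map_mul, levelFrob_pow_levelC, map_pow, pow_add, RingHom.mul_def, RingHom.comp_apply]

variable {g} in
-- Only the summand `n = deg g`, `i = 0` reaches `T ^ (deg g - 1)`, so the top coefficient recovers
-- the torsion point.
theorem topCoeff_levelFrob_pow_genFun (hg : g.Monic) (hpos : 0 < g.natDegree) (j : ℕ)
    (x : ResClosure f) :
    topCoeff f hg ((levelFrob f g ^ j) (genFun φ f g x)) = x ^ Fintype.card F ^ j := by
  have hsmul : ∀ (b : F) (s : LevelRing f g), topCoeff f hg (b • s) = b • topCoeff f hg s :=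
    fun b s => LinearMap.map_smul_of_tower _ b s
  rw [levelFrob_pow_genFun, map_sum, Finset.sum_range_succ, Finset.sum_eq_zero, zero_add, hsmul,
    hg.coeff_natDegree, one_smul, map_sum, Finset.sum_eq_single 0]
  · rw [topCoeff_mul_pow f hg _ (by omega), if_pos (by omega)]
    simp
  · intro i hi h0
    have := Finset.mem_range.mp hi
    rw [topCoeff_mul_pow f hg _ (by omega), if_neg (by omega)]
  · intro h
    simp [hpos.ne'] at h
  · intro n hn
    have hn' := Finset.mem_range.mp hn
    rw [hsmul, map_sum, Finset.sum_eq_zero, smul_zero]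
    intro i hi
    have := Finset.mem_range.mp hi
    rw [topCoeff_mul_pow f hg _ (by omega), if_neg (by omega)]

end Anderson

/-! ### The characteristic polynomial of the Frobenius at finite level -/

section Level

variable {F : Type*} [Field F] [Fintype F] (φ : DrinfeldModule F) (f : MonicIrred F)

/-- A `q`-polynomial with more than `q ^ (N - 1)` zeros vanishes. -/
theorem eq_zero_of_sum_mul_pow {L : Type*} [Field L] {q N : ℕ} (hq : 1 < q) {c : Fin N → L}
    {V : Set L} (hV : Nat.card V = q ^ N) (h : ∀ x ∈ V, ∑ j, c j * x ^ q ^ (j : ℕ) = 0)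
    (j : Fin N) : c j = 0 := by
  have hN : 0 < N := j.pos
  let p : L[X] := ∑ j, C (c j) * X ^ q ^ (j : ℕ)
  have hp : p = 0 := by
    by_contra hp
    have hfin : Finite V := Nat.finite_of_card_ne_zero (by rw [hV]; positivity)
    have hsub : V ⊆ p.rootSet L := fun x hx => by
      rw [mem_rootSet_of_ne hp]
      simpa [p] using h x hx
    have h1 : Nat.card V ≤ p.natDegree := by
      rw [Nat.card_coe_set_eq]
      exact (Set.ncard_le_ncard hsub (rootSet_finite _ _)).trans (ncard_rootSet_le _ _)
    have h2 : p.natDegree ≤ q ^ (N - 1) := natDegree_sum_le_of_forall_le _ _ fun i _ =>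
      (natDegree_C_mul_X_pow_le _ _).trans (Nat.pow_le_pow_right (by omega) (by omega))
    have h3 : q ^ (N - 1) < q ^ N := Nat.pow_lt_pow_right hq (by omega)
    omega
  have h4 := congrArg (fun p => p.coeff (q ^ (j : ℕ))) hp
  simp only [p, finsetSum_coeff, coeff_C_mul, coeff_X_pow, coeff_zero, mul_ite, mul_one,
    mul_zero] at h4
  rw [Finset.sum_eq_single j] at h4
  · simpa using h4
  · intro i _ hij
    rw [if_neg]
    intro he
    exact hij (Fin.ext (Nat.pow_right_injective hq he).symm)
  · simp

variable {g : F[X]} {E : Fin (redRank φ f) → ResClosure f}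

/-- The vector of the Frobenius twists of the generating functions of the elements `E l`. -/
def genVec (g : F[X]) (E : Fin (redRank φ f) → ResClosure f) (n : ℕ) :
    Fin (redRank φ f) → LevelRing f g :=
  fun l => (levelFrob f g ^ n) (genFun φ f g (E l))

/-- The first `r₀ deg g` twists are already independent, and their number is the dimension of the
space. Taking top coefficients of a relation gives `∑ c_j x ^ (q ^ j) = 0` for all `x` in the
`g`-torsion, which has too many elements for a nonzero `q`-polynomial of this degree. -/
theorem span_genVec (hg : g.Monic) (hpos : 0 < g.natDegree) (hfg : ¬ f.1 ∣ g)
    (hE : ∀ l, aeval (redOp φ f) g (E l) = 0)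
    (hgen : ∀ x, aeval (redOp φ f) g x = 0 →
      ∃ a : Fin (redRank φ f) → F[X], ∑ l, aeval (redOp φ f) (a l) (E l) = x) :
    Submodule.span (ResClosure f) (Set.range (genVec φ f g E)) = ⊤ := by
  set N := redRank φ f * g.natDegree with hN
  have hfin : Module.Finite (ResClosure f) (LevelRing f g) := (hg.map _).finite_adjoinRoot
  have hrank : Module.finrank (ResClosure f) (Fin (redRank φ f) → LevelRing f g) = N := by
    rw [Module.finrank_pi_fintype]
    simp [(AdjoinRoot.powerBasis' (hg.map (algebraMap F (ResClosure f)))).finrank, hN]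
  have hli : LinearIndependent (ResClosure f) fun j : Fin N => genVec φ f g E j := by
    rw [Fintype.linearIndependent_iff]
    intro c hc
    refine eq_zero_of_sum_mul_pow Fintype.one_lt_card (card_torsion φ hfg) fun x hx => ?_
    obtain ⟨a, rfl⟩ := hgen x hx
    have h1 : ∀ l, ∑ j : Fin N, c j • (levelFrob f g ^ (j : ℕ)) (genFun φ f g (E l)) = 0 := by
      intro l
      have := congrFun hc l
      simpa [genVec, Finset.sum_apply] using this
    have h2 : ∑ j : Fin N, c j • (levelFrob f g ^ (j : ℕ))
        (genFun φ f g (∑ l, aeval (redOp φ f) (a l) (E l))) = 0 := by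
      simp only [map_sum, genFun_aeval φ f g (hE _), map_mul, levelFrob_pow_aeval, Finset.smul_sum]
      rw [Finset.sum_comm]
      refine Finset.sum_eq_zero fun l _ => ?_
      simp only [← mul_smul_comm]
      rw [← Finset.mul_sum, h1, mul_zero]
    generalize ∑ l, aeval (redOp φ f) (a l) (E l) = x at h2 ⊢
    have h3 := congrArg (topCoeff f hg) h2
    simpa only [map_sum, map_smul, topCoeff_levelFrob_pow_genFun φ f hg hpos, smul_eq_mul,
      map_zero] using h3
  have h4 := hli.span_eq_top_of_card_eq_finrank' (by rw [hrank, Fintype.card_fin])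
  rw [eq_top_iff, ← h4]
  refine Submodule.span_mono ?_
  rintro _ ⟨j, rfl⟩
  exact ⟨j, rfl⟩

theorem map_localPoly_level (g : F[X]) :
    (localPoly φ f).map (aeval (levelT f g) : F[X] →ₐ[F] LevelRing f g).toRingHom =
      twistDet (Fintype.card F) f.1.natDegree φ.rank (fun i => C (levelC f g (resCoeff φ f i)))
        (C (levelT f g)) X := by
  -- Constants of `A / f` go to constants and the variable to the class of `T`; the identity
  -- defining `localPoly` is transported along this map.
  let ι : (AdjoinRoot f.1)[X] →+* LevelRing f g :=
    eval₂RingHom ((levelC f g).comp (algebraMap (AdjoinRoot f.1) (ResClosure f))) (levelT f g)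
  have h := congrArg (Polynomial.map ι) (map_localPoly φ f)
  rw [← coe_mapRingHom ι, twistPoly, map_twistDet, coe_mapRingHom, map_map] at h
  simp only [map_C, map_X] at h
  have e1 : ι.comp (mapRingHom (algebraMap F (AdjoinRoot f.1))) =
      (aeval (levelT f g) : F[X] →ₐ[F] LevelRing f g).toRingHom := by
    refine Polynomial.ringHom_ext (fun a => ?_) ?_
    · simp only [ι, RingHom.comp_apply, coe_mapRingHom, map_C, coe_eval₂RingHom, eval₂_C,
        ← IsScalarTower.algebraMap_apply]
      exact (aeval_C (levelT f g) a).symm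
    · simp [ι]
  have e2 : ∀ c, ι (C c) = levelC f g (algebraMap _ _ c) := fun c => eval₂_C _ _
  have e3 : ι X = levelT f g := eval₂_X _ _
  rw [e1] at h
  simp only [e2, e3] at h
  exact h

/-- The characteristic polynomial of the Frobenius on `N[g]` divides `localPoly` modulo `g`. -/
theorem map_charpoly_dvd_map_localPoly (hg : g.Monic) (hpos : 0 < g.natDegree) (hfg : ¬ f.1 ∣ g)
    (hE : ∀ l, aeval (redOp φ f) g (E l) = 0)
    (hgen : ∀ x, aeval (redOp φ f) g x = 0 →
      ∃ a : Fin (redRank φ f) → F[X], ∑ l, aeval (redOp φ f) (a l) (E l) = x)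
    {G : Matrix (Fin (redRank φ f)) (Fin (redRank φ f)) F[X]}
    (hG : ∀ j, E j ^ Fintype.card F ^ f.1.natDegree = ∑ i, aeval (redOp φ f) (G i j) (E i)) :
    G.charpoly.map (aeval (levelT f g) : F[X] →ₐ[F] LevelRing f g).toRingHom ∣
      (localPoly φ f).map (aeval (levelT f g) : F[X] →ₐ[F] LevelRing f g).toRingHom := by
  set ρ := (aeval (levelT f g) : F[X] →ₐ[F] LevelRing f g).toRingHom with hρ
  set d := f.1.natDegree with hd
  set v := genVec φ f g E with hv
  -- `G` acts on the torsion points, so its transpose acts on the vector of their generating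
  -- functions; there it agrees with twisting `d` times.
  let u : Module.End (LevelRing f g) (Fin (redRank φ f) → LevelRing f g) :=
    Matrix.toLin' (G.transpose.map ρ)
  have hu : ∀ n, v (n + d) = u (v n) := by
    intro n
    ext1 l
    simp only [v, genVec, u, Matrix.toLin'_apply, Matrix.mulVec, dotProduct, Matrix.map_apply,
      Matrix.transpose_apply]
    rw [pow_add, RingHom.mul_def, RingHom.comp_apply, levelFrob_pow_natDegree_genFun, hG, map_sum,
      map_sum]
    refine Finset.sum_congr rfl fun i _ => ?_
    rw [genFun_aeval φ f g (hE i), map_mul, levelFrob_pow_aeval]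
    rfl
  have hupow : ∀ m n, v (n + m * d) = (u ^ m) (v n) := by
    intro m n
    induction m with
    | zero => simp
    | succ m ih => rw [Nat.succ_mul, ← add_assoc, hu, ih, pow_succ', Module.End.mul_apply]
  have hT : ∀ n, ∑ i ∈ Finset.range (φ.rank + 1),
      (levelC f g (resCoeff φ f i)) ^ Fintype.card F ^ n • v (n + i) = levelT f g • v n := by
    intro n
    ext1 l
    simp only [Finset.sum_apply, Pi.smul_apply, smul_eq_mul, v, genVec]
    rw [levelT_mul_genFun φ f g (hE l)]
  have key := charpoly_dvd_det (Pi.basisFun (LevelRing f g) (Fin (redRank φ f))) u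
    (fun j : Fin d => v j)
    (Matrix.scalar (Fin d) (C (levelT f g)) - twistMatrix (Fintype.card F) d φ.rank
      (fun i => C (levelC f g (resCoeff φ f i))) X) ?_ ?_
  · rw [LinearMap.toMatrix_eq_toMatrix', LinearMap.toMatrix'_toLin', Matrix.charpoly_map,
      Matrix.charpoly_transpose] at key
    rw [map_localPoly_level φ f g]
    exact key
  · intro w
    have hw : w ∈ Submodule.span (ResClosure f) (Set.range v) := by
      rw [hv, span_genVec φ f hg hpos hfg hE hgen]
      trivial
    induction hw using Submodule.span_induction with
    | mem w hw =>
      obtain ⟨n, rfl⟩ := hw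
      -- `v n` is `u ^ (n / d)` applied to `v (n % d)`, so the first `d` twists generate once `X`
      -- acts through `u`.
      refine ⟨Pi.single ⟨n % d, Nat.mod_lt _ (natDegree_pos f)⟩ (X ^ (n / d)), ?_⟩
      rw [Finset.sum_eq_single ⟨n % d, Nat.mod_lt _ (natDegree_pos f)⟩]
      · rw [Pi.single_eq_same, aeval_X_pow, ← hupow, mul_comm, Nat.mod_add_div]
      · intro j _ hj
        rw [Pi.single_eq_of_ne hj, map_zero, LinearMap.zero_apply]
      · simp
    | zero => exact ⟨0, by simp⟩
    | add w w' _ _ h1 h2 =>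
      obtain ⟨β, hβ⟩ := h1
      obtain ⟨β', hβ'⟩ := h2
      exact ⟨β + β', by simp [Finset.sum_add_distrib, hβ, hβ']⟩
    | smul c w _ h1 =>
      obtain ⟨β, hβ⟩ := h1
      refine ⟨fun j => C (levelC f g c) * β j, ?_⟩
      simp only [map_mul, aeval_C, Module.End.mul_apply, Module.algebraMap_end_apply]
      rw [← Finset.smul_sum, hβ]
      ext1 l
      simp [Algebra.smul_def]
  · intro j
    have h1 := twistMatrix_smul (B := (LevelRing f g)[X]) (H := Module.AEval' u) (x := X)
      (v := fun n => Module.AEval'.of u (v n)) (natDegree_pos f)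
      (fun n => by rw [Module.AEval'.X_smul_of, hu]) (Fintype.card F) φ.rank
      (fun i => C (levelC f g (resCoeff φ f i))) j
    simp only [← C_pow, ← Module.AEval.of_aeval_smul] at h1
    simp only [← map_sum] at h1
    have h2 := (Module.AEval'.of u).injective h1
    simp only [Module.End.smul_def, aeval_C, Module.algebraMap_end_apply] at h2
    rw [hT] at h2
    simp only [Matrix.sub_apply, map_sub, LinearMap.sub_apply, Finset.sum_sub_distrib]
    rw [h2, sub_eq_zero, Finset.sum_eq_single j]
    · simp
    · intro l _ hl
      simp [hl.symm]
    · simp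

end Level

/-! ### The polynomials `P_f` and `D_f` -/

theorem charpoly_toMatrix_eq {R M ι κ : Type*} [CommRing R] [AddCommGroup M] [Module R M]
    [Fintype ι] [DecidableEq ι] [Fintype κ] [DecidableEq κ] (b : Module.Basis ι R M)
    (b' : Module.Basis κ R M) (u : M →ₗ[R] M) :
    (LinearMap.toMatrix b b u).charpoly = (LinearMap.toMatrix b' b' u).charpoly := by
  have : Module.Free R M := Module.Free.of_basis b
  have : Module.Finite R M := Module.Finite.of_basis b
  nontriviality R
  rw [LinearMap.charpoly_toMatrix, LinearMap.charpoly_toMatrix]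

section FrobPoly

variable {F : Type*} [Field F] (φ : DrinfeldModule F) (f : MonicIrred F)

/-- For degree reasons no nonzero polynomial is divisible by all powers of `h`. -/
theorem algebraMap_adicCompletion_injective (h : MonicIrred F) :
    Function.Injective (algebraMap F[X] (AdicCompletion (Ideal.span {h.1}) F[X])) := by
  rw [injective_iff_map_eq_zero]
  intro a ha
  by_contra h0
  have h1 : ∀ k, h.1 ^ k ∣ a := by
    intro k
    have h2 := congrArg (AdicCompletion.evalₐ (Ideal.span {h.1}) k) ha
    rw [AlgHom.commutes, map_zero] at h2
    rwa [← Ideal.mem_span_singleton, ← Ideal.span_singleton_pow, ← Ideal.Quotient.eq_zero_iff_mem]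
  have h3 := natDegree_le_of_dvd (h1 (a.natDegree + 1)) h0
  rw [natDegree_pow] at h3
  have := natDegree_pos h
  nlinarith

theorem exists_monicIrred_ne : ∃ h : MonicIrred F, h ≠ f := by
  let x : F → MonicIrred F := fun a => ⟨X - C a, monic_X_sub_C a, irreducible_X_sub_C a⟩
  have hx : x 0 ≠ x 1 := fun h => zero_ne_one (α := F)
    (C_injective (sub_right_injective (congrArg Subtype.val h)))
  by_cases h : x 0 = f
  · exact ⟨x 1, fun h' => hx (h.trans h'.symm)⟩
  · exact ⟨x 0, h⟩

variable [Fintype F]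

/-- In rank `0` the polynomial `Q_f` is `f`, which is not a constant multiple of the characteristic
polynomial `1` on the zero module; hence the separate case. -/
theorem exists_charpoly_localPoly : ∃ (P : F[X][X]) (a : F), a ≠ 0 ∧ P.Monic ∧
    P.natDegree = redRank φ f ∧ (0 < redRank φ f → P = C (C a) * localPoly φ f) := by
  rcases Nat.eq_zero_or_pos (redRank φ f) with h | h
  · exact ⟨1, 1, one_ne_zero, monic_one, by simp [h], by omega⟩
  · obtain ⟨a, ha, e⟩ := coeff_localPoly_redRank φ f h
    refine ⟨C (C a⁻¹) * localPoly φ f, a⁻¹, inv_ne_zero ha, ?_, ?_, fun _ => rfl⟩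
    · rw [Monic, leadingCoeff_mul, leadingCoeff_C, leadingCoeff, natDegree_localPoly, e, ← C_mul,
        inv_mul_cancel₀ ha, C_1]
    · rw [natDegree_C_mul (C_ne_zero.mpr (inv_ne_zero ha)), natDegree_localPoly]

/-- The characteristic polynomial of the Frobenius at `f`, as a multiple of `localPoly` if the
reduction has positive rank. -/
def frobCharpoly : F[X][X] := (exists_charpoly_localPoly φ f).choose

theorem frobCharpoly_spec : ∃ a : F, a ≠ 0 ∧ (frobCharpoly φ f).Monic ∧
    (frobCharpoly φ f).natDegree = redRank φ f ∧
    (0 < redRank φ f → frobCharpoly φ f = C (C a) * localPoly φ f) :=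
  (exists_charpoly_localPoly φ f).choose_spec

theorem frobEnd_of (x : ResClosure f) : frobEnd φ f (Module.AEval'.of (redOp φ f) x) =
    Module.AEval'.of (redOp φ f) (x ^ Fintype.card F ^ f.1.natDegree) := by
  rw [← resFrob_pow_apply]
  rfl

variable {f} in
-- Modulo `h ^ k` one monic polynomial divides another of the same degree `r₀`, so they agree.
theorem isFrobCharpoly_frobCharpoly {h : MonicIrred F} (hne : h ≠ f) :
    IsFrobCharpoly φ f h (frobCharpoly φ f) := by
  obtain ⟨e, he, hgen, hind⟩ := exists_torsion_basis φ hne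
  refine ⟨redRank φ f, exists_tateModule_basis_charpoly (smul_surjective φ (not_dvd_of_ne f hne))
    he hgen hind (frobEnd φ f) (frobCharpoly φ f) ?_⟩
  intro k E G hE hgenE _ hG n
  obtain ⟨a, ha, hmonic, hdeg, hloc⟩ := frobCharpoly_spec φ f
  rcases Nat.eq_zero_or_pos (redRank φ f) with h0 | hpos
  · have h1 : frobCharpoly φ f = 1 := by
      rw [h0] at hdeg
      exact hmonic.natDegree_eq_zero.mp hdeg
    have h2 : G.charpoly = 1 := by
      have : IsEmpty (Fin (redRank φ f)) := by rw [h0]; infer_instance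
      rw [Matrix.charpoly, Matrix.det_isEmpty]
    rw [h1, h2, sub_self, coeff_zero]
    exact dvd_zero _
  rcases Nat.eq_zero_or_pos k with rfl | hk
  · rw [pow_zero]; exact one_dvd _
  have hg : (h.1 ^ k).Monic := h.2.1.pow k
  have hgpos : 0 < (h.1 ^ k).natDegree := by
    rw [natDegree_pow]
    exact Nat.mul_pos hk (natDegree_pos h)
  have hfg : ¬ f.1 ∣ h.1 ^ k := fun hd => not_dvd_of_ne f hne (f.2.2.prime.dvd_of_dvd_pow hd)
  have key := map_charpoly_dvd_map_localPoly φ f hg hgpos hfg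
    (E := fun l => (Module.AEval'.of (redOp φ f)).symm (E l)) (G := G) hE
    (fun x hx => hgenE x hx)
    (fun j => (frobEnd_of φ f ((Module.AEval'.of (redOp φ f)).symm (E j))).symm.trans (hG j))
  set ρ := (aeval (levelT f (h.1 ^ k)) : F[X] →ₐ[F] LevelRing f (h.1 ^ k)).toRingHom
  have : Nontrivial (LevelRing f (h.1 ^ k)) := AdjoinRoot.nontrivial _ (by
    rw [degree_map, degree_eq_natDegree hg.ne_zero]
    exact_mod_cast hgpos.ne')
  have hdvd : G.charpoly.map ρ ∣ (frobCharpoly φ f).map ρ := by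
    rw [hloc hpos, Polynomial.map_mul]
    exact key.mul_left _
  have heq : (frobCharpoly φ f).map ρ = G.charpoly.map ρ := by
    refine eq_of_monic_of_dvd_of_natDegree_le (G.charpoly_monic.map ρ) (hmonic.map ρ) hdvd ?_
    rw [hmonic.natDegree_map, G.charpoly_monic.natDegree_map, hdeg,
      Matrix.charpoly_natDegree_eq_dim, Fintype.card_fin]
  have h3 : ρ ((G.charpoly - frobCharpoly φ f).coeff n) = 0 := by
    rw [← coeff_map, Polynomial.map_sub, heq, sub_self, coeff_zero]
  have h4 : ρ ((G.charpoly - frobCharpoly φ f).coeff n) = AdjoinRoot.mk _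
      (((G.charpoly - frobCharpoly φ f).coeff n).map (algebraMap F (ResClosure f))) := by
    rw [← AdjoinRoot.aeval_eq, aeval_map_algebraMap]
    rfl
  rw [h4, AdjoinRoot.mk_eq_zero] at h3
  -- Divisibility by `h ^ k` descends from the algebraic closure of `A / f` to `F`.
  exact (map_dvd_map' _).mp h3

variable {φ f} in
theorem IsFrobCharpoly.unique {h : MonicIrred F} {P P' : F[X][X]} (hP : IsFrobCharpoly φ f h P)
    (hP' : IsFrobCharpoly φ f h P') : P = P' := by
  obtain ⟨m, b, hb⟩ := hP
  obtain ⟨m', b', hb'⟩ := hP'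
  have e := charpoly_toMatrix_eq (R := AdicCompletion (Ideal.span {h.1}) F[X])
    (M := tateModule (RedModule φ f) h.1) b b' (tateMap h.1 (frobEnd φ f))
  exact map_injective _ (algebraMap_adicCompletion_injective h) (hb.symm.trans (e.trans hb'))

theorem frobPoly_eq : frobPoly φ f = frobCharpoly φ f := by
  have H : ∃ P : F[X][X], ∀ h : MonicIrred F, h ≠ f → IsFrobCharpoly φ f h P :=
    ⟨_, fun _ => isFrobCharpoly_frobCharpoly φ⟩
  obtain ⟨h, hh⟩ := exists_monicIrred_ne f
  rw [frobPoly, dif_pos H]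
  exact (H.choose_spec h hh).unique (isFrobCharpoly_frobCharpoly φ hh)

/-- The constant `c(f)` is the leading coefficient of `Q_f` in `x` and undoes the normalization of
`P_f`. -/
theorem eulerPoly_eq : eulerPoly φ f = 1 + ∑ i ∈ Finset.Icc 1 (redRank φ f),
    C ((localPoly φ f).coeff i * f.1 ^ (i - 1)) * X ^ i := by
  obtain ⟨a, ha, -, hdeg, hloc⟩ := frobCharpoly_spec φ f
  rw [eulerPoly, frobPoly_eq, hdeg]
  congr 1
  refine Finset.sum_congr rfl fun i hi => ?_
  have hpos : 0 < redRank φ f := by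
    have := Finset.mem_Icc.mp hi
    omega
  have hc : frobConst φ f = a⁻¹ := by
    rw [frobConst, frobPoly_eq, hloc hpos, coeff_C_mul, localPoly_coeff_zero, leadingCoeff_mul,
      leadingCoeff_C, f.2.1.leadingCoeff, mul_one]
  rw [hc, hloc hpos, coeff_C_mul, ← mul_assoc (C a⁻¹), ← C_mul, inv_mul_cancel₀ ha, C_1, one_mul]

theorem coeff_eulerPoly_zero : (eulerPoly φ f).coeff 0 = 1 := by
  rw [eulerPoly_eq, coeff_add, coeff_one_zero, finsetSum_coeff, Finset.sum_eq_zero, add_zero]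
  intro i hi
  have := Finset.mem_Icc.mp hi
  rw [coeff_C_mul_X_pow, if_neg (by omega)]

theorem coeff_eulerPoly_of_pos {i : ℕ} (hi : 0 < i) :
    (eulerPoly φ f).coeff i = (localPoly φ f).coeff i * f.1 ^ (i - 1) := by
  rw [eulerPoly_eq, coeff_add, coeff_one, if_neg hi.ne', zero_add, finsetSum_coeff]
  simp only [coeff_C_mul_X_pow]
  rw [Finset.sum_ite_eq]
  split_ifs with h
  · rfl
  · rw [coeff_eq_zero_of_natDegree_lt, zero_mul]
    rw [natDegree_localPoly]
    rw [Finset.mem_Icc] at h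
    omega

end FrobPoly

/-! ### The action of `ψ_θ` on the quotient by `f` -/

section PsiCharpoly

variable {F : Type*} [Field F] (n : ℕ) (φ : DrinfeldModule F) (f : MonicIrred F)

/-- The element `t ^ d f(z₁) ⋯ f(z_n)`, where `d = deg f`. -/
def evalProd (a : F[X]) : BaseField F n :=
  (∏ j : Fin n, aeval (zVar F n j) a) * tVar F n ^ a.natDegree

theorem aeval_zVar_ne_zero {a : F[X]} (ha : a ≠ 0) (j : Fin n) : aeval (zVar F n j) a ≠ 0 := by
  have h : Transcendental F (zVar F n j) :=
    (transcendental_algebraMap_iff (IsFractionRing.injective _ _)).mpr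
      (MvPolynomial.transcendental_X F (Sum.inl j))
  exact fun h0 => h ⟨a, ha, h0⟩

theorem tVar_ne_zero : tVar F n ≠ 0 := by
  rw [tVar, Ne, FaithfulSMul.algebraMap_eq_zero_iff]
  exact MvPolynomial.X_ne_zero _

theorem evalProd_ne_zero {a : F[X]} (ha : a ≠ 0) : evalProd n a ≠ 0 :=
  mul_ne_zero (Finset.prod_ne_zero_iff.mpr fun j _ => aeval_zVar_ne_zero n ha j)
    (pow_ne_zero _ (tVar_ne_zero n))

/-- An algebraic closure of `𝔽_q(z₁, …, z_n, t)`. -/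
abbrev BaseClosure (F : Type*) [Field F] (n : ℕ) := AlgebraicClosure (BaseField F n)

theorem exists_root_closure : ∃ x : BaseClosure F n, aeval x f.1 = 0 :=
  IsAlgClosed.exists_aeval_eq_zero _ _ (degree_pos_of_irreducible f.2.2).ne'

/-- A root of `f` in an algebraic closure. -/
def rootClosure : BaseClosure F n := (exists_root_closure n f).choose

theorem aeval_rootClosure : aeval (rootClosure n f) f.1 = 0 := (exists_root_closure n f).choose_spec

theorem exists_pow_basis : ∃ b : Module.Basis (Fin f.1.natDegree) (BaseField F n) (PrimeQuot n f),
    ∀ l, b l = Ideal.Quotient.mk _ (X ^ (l : ℕ)) := by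
  have hm := f.2.1.map (algebraMap F (BaseField F n))
  have hdim : (AdjoinRoot.powerBasis' hm).dim = f.1.natDegree := by
    rw [AdjoinRoot.powerBasis'_dim, natDegree_map]
  let e : AdjoinRoot (baseChange n f.1) ≃ₗ[BaseField F n] PrimeQuot n f :=
    { toFun := id, invFun := id, map_add' := fun _ _ => rfl, map_smul' := fun _ _ => rfl }
  refine ⟨((AdjoinRoot.powerBasis' hm).basis.reindex (finCongr hdim)).map e, fun l => ?_⟩
  rw [Module.Basis.map_apply, Module.Basis.reindex_apply, PowerBasis.basis_eq_pow,
    AdjoinRoot.powerBasis'_gen]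
  rfl

/-- By Cayley–Hamilton applied to the class of `1`, `f` divides the characteristic polynomial of
`θ`; the degrees agree. -/
theorem fittingGen_primeQuot : fittingGen (BaseField F n) (PrimeQuot n f) = baseChange n f.1 := by
  obtain ⟨b, -⟩ := exists_pow_basis n f
  refine eq_of_monic_of_dvd_of_natDegree_le (f.2.1.map _) (LinearMap.charpoly_monic _) ?_ ?_
  · have h := LinearMap.aeval_self_charpoly
      (Algebra.lsmul (BaseField F n) (BaseField F n) (PrimeQuot n f)
        (X : (BaseField F n)[X]))
    rw [aeval_algHom_apply, aeval_X_left_apply] at h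
    have h1 := LinearMap.congr_fun h 1
    rw [← Ideal.mem_span_singleton, ← Ideal.Quotient.eq_zero_iff_mem]
    have hs : ∀ p : (BaseField F n)[X],
        Ideal.Quotient.mk (primeIdeal n f) p = p • (1 : PrimeQuot n f) :=
      fun p => (congrArg (Ideal.Quotient.mk (primeIdeal n f)) (mul_one p)).symm
    exact (hs _).trans h1
  · rw [fittingGen, LinearMap.charpoly_natDegree, natDegree_map,
      Module.finrank_eq_card_basis b, Fintype.card_fin]

variable [Fintype F]

/-- The embedding of `A / f A` in an algebraic closure of `𝔽_q(z₁, …, z_n, t)`. -/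
def resEmb : AdjoinRoot f.1 →+* BaseClosure F n :=
  AdjoinRoot.lift (algebraMap F (BaseClosure F n)) (rootClosure n f)
    ((aeval_def _ _).symm.trans (aeval_rootClosure n f))

/-- The conjugates `ϑ ^ (q ^ i)` of the root `ϑ` of `f`. -/
def conjRoot (i : ℕ) : BaseClosure F n := rootClosure n f ^ Fintype.card F ^ i

theorem resEmb_root_pow (i : ℕ) :
    resEmb n f (AdjoinRoot.root f.1 ^ Fintype.card F ^ i) = conjRoot n f i := by
  rw [map_pow, resEmb, AdjoinRoot.lift_root, conjRoot]

theorem conjRoot_add_natDegree (i : ℕ) : conjRoot n f (i + f.1.natDegree) = conjRoot n f i := by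
  rw [← resEmb_root_pow, ← resEmb_root_pow, pow_add, mul_comm, pow_mul, pow_card_pow]

theorem conjRoot_pow (i j : ℕ) : conjRoot n f i ^ Fintype.card F ^ j = conjRoot n f (i + j) := by
  rw [conjRoot, conjRoot, ← pow_mul, ← pow_add]

theorem conjRoot_injective :
    Function.Injective fun j : Fin f.1.natDegree => conjRoot n f j := by
  simp only [← resEmb_root_pow]
  exact (resEmb n f).injective.comp (root_pow_card_pow_injective f)

theorem aeval_conjRoot (i : ℕ) (a : F[X]) :
    aeval (conjRoot n f i) a = resEmb n f (AdjoinRoot.mk f.1 a) ^ Fintype.card F ^ i := by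
  have h1 : resEmb n f (AdjoinRoot.mk f.1 a) = aeval (rootClosure n f) a := by
    rw [resEmb, AdjoinRoot.lift_mk]; rfl
  have h2 : ∀ x : BaseClosure F n, x ^ Fintype.card F ^ i =
      (FiniteField.frobeniusAlgHom F (BaseClosure F n) ^ i) x := by
    intro x
    induction i with
    | zero => simp
    | succ i ih =>
      rw [pow_succ' (FiniteField.frobeniusAlgHom F (BaseClosure F n)), AlgHom.mul_apply, ← ih,
        FiniteField.coe_frobeniusAlgHom]
      simp only [← pow_mul, pow_succ]
  rw [h1, h2, ← aeval_algHom_apply, ← h2, conjRoot]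

theorem prod_sub_conjRoot (z : BaseField F n) :
    ∏ i ∈ Finset.range f.1.natDegree, (algebraMap _ (BaseClosure F n) z - conjRoot n f i) =
      algebraMap _ (BaseClosure F n) (aeval z f.1) := by
  have h := congrArg (fun p => (p.map (resEmb n f)).eval (algebraMap _ (BaseClosure F n) z))
    (prod_X_sub_C_root_pow f)
  simp only [Polynomial.map_prod, Polynomial.map_sub, map_X, map_C, resEmb_root_pow, eval_prod,
    eval_sub, eval_X, eval_C, map_map] at h
  rw [Finset.prod_range, h, ← aeval_algebraMap_apply, ← eval_map_algebraMap]
  congr 2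
  exact RingHom.ext fun a => by
    rw [RingHom.comp_apply, resEmb, AdjoinRoot.algebraMap_eq, AdjoinRoot.lift_of]

/-- The product `t ^ i ℓ_i(z₁) ⋯ ℓ_i(z_n)` evaluated at the root of `f`. -/
def weight (i : ℕ) : BaseClosure F n :=
  algebraMap _ _ (tVar F n) ^ i * ∏ j : Fin n, ∏ l ∈ Finset.range i,
    (algebraMap _ (BaseClosure F n) (zVar F n j) - conjRoot n f l)

theorem weight_add (i m : ℕ) : weight n f (i + m) = weight n f i *
    (algebraMap _ _ (tVar F n) ^ m * ∏ j : Fin n, ∏ l ∈ Finset.range m,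
      (algebraMap _ (BaseClosure F n) (zVar F n j) - conjRoot n f (i + l))) := by
  simp only [weight, Finset.prod_range_add, Finset.prod_mul_distrib, pow_add]
  ring

theorem weight_natDegree : weight n f f.1.natDegree = algebraMap _ _ (evalProd n f.1) := by
  simp only [weight, prod_sub_conjRoot, evalProd, map_mul, map_prod, map_pow]
  ring

/-- Conjugates are periodic with period `d`, and a full period contributes `t ^ d` times the
products of `z_j - ϑ'` over all conjugates `ϑ'`, which are the `f(z_j)`. -/
theorem weight_add_natDegree (i : ℕ) :
    weight n f (i + f.1.natDegree) = algebraMap _ _ (evalProd n f.1) * weight n f i := by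
  rw [add_comm, weight_add, weight_natDegree]
  congr 1
  simp only [add_comm f.1.natDegree, conjRoot_add_natDegree]
  rfl

theorem weight_ne_zero {i : ℕ} (hi : i ≤ f.1.natDegree) : weight n f i ≠ 0 := by
  obtain ⟨m, hm⟩ := Nat.exists_eq_add_of_le hi
  have h := weight_natDegree n f
  rw [hm, weight_add] at h
  intro h0
  rw [h0, zero_mul] at h
  exact evalProd_ne_zero n f.2.1.ne_zero ((map_eq_zero _).mp h.symm)

/-- Evaluation at the conjugate `ϑ ^ (q ^ i)` of the root `ϑ` of `f`. -/
def evConj (i : ℕ) : PrimeQuot n f →ₐ[BaseField F n] BaseClosure F n :=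
  Ideal.Quotient.liftₐ _ (aeval (conjRoot n f i)) (by
    intro a ha
    obtain ⟨b, rfl⟩ := Ideal.mem_span_singleton.mp ha
    rw [map_mul, aeval_map_algebraMap, aeval_conjRoot, AdjoinRoot.mk_self, map_zero,
      zero_pow (pow_pos Fintype.card_pos _).ne', zero_mul])

theorem evConj_mk (i : ℕ) (p : (BaseField F n)[X]) :
    evConj n f i (Ideal.Quotient.mk _ p) = aeval (conjRoot n f i) p := rfl

/-- `τ` fixes `k` and raises `θ` to the `q`-th power, so it moves evaluation to the next conjugate.
-/
theorem evConj_quotFrob_pow (i m : ℕ) (w : PrimeQuot n f) :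
    evConj n f i (((quotFrob n f).toLinearMap ^ m) w) = evConj n f (i + m) w := by
  induction m generalizing i with
  | zero => simp
  | succ m ih =>
    rw [pow_succ', Module.End.mul_apply]
    have h : ∀ w, evConj n f i (quotFrob n f w) = evConj n f (i + 1) w := by
      intro w
      obtain ⟨p, rfl⟩ := Ideal.Quotient.mk_surjective w
      rw [quotFrob, Ideal.quotient_map_mkₐ, Ideal.Quotient.mkₐ_eq_mk, evConj_mk, evConj_mk,
        expand_aeval, ← conjRoot_pow, pow_one]
    rw [AlgHom.toLinearMap_apply, h, ih, add_assoc, add_comm 1]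

/-- The twisted factors `t ^ i ℓ_i(z)` are exactly the quotient of the weights at `j + i` and `j`.
So passing to weighted evaluations turns `ψ` back into `φ`. -/
theorem aeval_psiCoeff (j i : ℕ) : weight n f j * aeval (conjRoot n f j) (psiCoeff n φ i) =
    resEmb n f (redCoeff φ f i) ^ Fintype.card F ^ j * weight n f (j + i) := by
  rw [weight_add, psiCoeff, map_mul, map_mul, aeval_C, aeval_map_algebraMap, aeval_conjRoot,
    redCoeff, map_prod]
  have h : ∀ l : Fin n, aeval (conjRoot n f j) (ell n i (zVar F n l)) = ∏ m ∈ Finset.range i,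
      (algebraMap _ (BaseClosure F n) (zVar F n l) - conjRoot n f (j + m)) := by
    intro l
    simp [ell, map_prod, conjRoot_pow]
  simp only [h, map_pow]
  ring

/-- The weighted evaluation functionals on the quotient by `f`. -/
def evWeight (i : ℕ) (w : PrimeQuot n f) : BaseClosure F n := weight n f i * evConj n f i w

theorem evWeight_psiOp (j : ℕ) (w : PrimeQuot n f) : evWeight n f j (psiOp n φ f w) =
    ∑ i ∈ Finset.range (φ.rank + 1),
      resEmb n f (redCoeff φ f i) ^ Fintype.card F ^ j • evWeight n f (j + i) w := by
  simp only [psiOp, skewOp, LinearMap.sum_apply, evWeight, map_sum, Finset.mul_sum,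
    Module.End.mul_apply, LinearMap.mulLeft_apply, map_mul, evConj_quotFrob_pow, evConj_mk]
  refine Finset.sum_congr rfl fun i _ => ?_
  rw [← mul_assoc, aeval_psiCoeff, smul_eq_mul, mul_assoc]

theorem evWeight_add_natDegree (j : ℕ) (w : PrimeQuot n f) :
    evWeight n f (j + f.1.natDegree) w =
      algebraMap _ (BaseClosure F n) (evalProd n f.1) • evWeight n f j w := by
  have h : evConj n f (j + f.1.natDegree) w = evConj n f j w := by
    obtain ⟨p, rfl⟩ := Ideal.Quotient.mk_surjective w
    rw [evConj_mk, evConj_mk, conjRoot_add_natDegree]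
  rw [evWeight, evWeight, h, weight_add_natDegree, smul_eq_mul, mul_assoc]

/-- The weighted evaluations at the `d` conjugates are a basis of functionals, since their matrix is
an invertible diagonal matrix times a Vandermonde matrix. In it `ψ_θ` becomes `twistMatrix` with `x
= t ^ d f(z₁) ⋯ f(z_n)`. -/
theorem charpoly_psiOp_map : (psiOp n φ f).charpoly.map (algebraMap _ (BaseClosure F n)) =
    twistDet (Fintype.card F) f.1.natDegree φ.rank (fun i => C (resEmb n f (redCoeff φ f i))) X
      (C (algebraMap _ (BaseClosure F n) (evalProd n f.1))) := by
  obtain ⟨b, hb⟩ := exists_pow_basis n f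
  set M := LinearMap.toMatrix b b (psiOp n φ f) with hM
  let W : Matrix (Fin f.1.natDegree) (Fin f.1.natDegree) (BaseClosure F n) :=
    Matrix.of fun j l => evWeight n f j (b l)
  have hW : W.det ≠ 0 := by
    have h1 : W = Matrix.diagonal (fun j : Fin f.1.natDegree => weight n f j) *
        Matrix.vandermonde fun j => conjRoot n f j := by
      ext j l
      simp [W, evWeight, hb, evConj_mk, Matrix.diagonal_mul, Matrix.vandermonde_apply]
    rw [h1, Matrix.det_mul, Matrix.det_diagonal]
    exact mul_ne_zero (Finset.prod_ne_zero_iff.mpr fun j _ => weight_ne_zero n f j.2.le)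
      (Matrix.det_vandermonde_ne_zero_iff.mpr (conjRoot_injective n f))
  have hmul : W * (algebraMap _ (BaseClosure F n)).mapMatrix M =
      twistMatrix (Fintype.card F) f.1.natDegree φ.rank (fun i => resEmb n f (redCoeff φ f i))
        (algebraMap _ (BaseClosure F n) (evalProd n f.1)) * W := by
    ext j l
    have h1 := twistMatrix_smul (v := fun m => evWeight n f m (b l)) (natDegree_pos f)
      (fun m => evWeight_add_natDegree n f m (b l))
      (Fintype.card F) φ.rank (fun i => resEmb n f (redCoeff φ f i)) j
    rw [← evWeight_psiOp] at h1
    rw [Matrix.mul_apply, Matrix.mul_apply]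
    refine Eq.trans ?_ h1.symm
    have h2 : psiOp n φ f (b l) = ∑ i, M i l • b i := by
      conv_lhs => rw [← b.sum_repr (psiOp n φ f (b l))]
      simp [hM, LinearMap.toMatrix_apply]
    rw [h2, evWeight, map_sum, Finset.mul_sum]
    refine Finset.sum_congr rfl fun i _ => ?_
    rw [map_smul, Algebra.smul_def, RingHom.mapMatrix_apply, Matrix.map_apply]
    simp only [W, Matrix.of_apply, evWeight]
    ring
  rw [← LinearMap.charpoly_toMatrix _ b, ← Matrix.charpoly_map, ← RingHom.mapMatrix_apply, ← hM,
    Matrix.charpoly, twistDet]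
  refine det_eq_of_mul_eq (W := C.mapMatrix W) ?_ ?_
  · rw [← RingHom.map_det]
    exact C_ne_zero.mpr hW
  · rw [Matrix.charmatrix, mul_sub, sub_mul, ← map_twistMatrix, ← map_mul, ← map_mul, hmul]
    congr 1
    exact ((Matrix.scalar_commute X (fun _ => Commute.all _ _) _).eq).symm

/-- The characteristic polynomial of `ψ_θ` modulo `f` is the value of `localPoly` at
`t ^ d f(z₁) ⋯ f(z_n)`. -/
theorem charpoly_psiOp : (psiOp n φ f).charpoly =
    ((localPoly φ f).map (mapRingHom (algebraMap F (BaseField F n)))).eval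
      (C (evalProd n f.1)) := by
  apply map_injective _ (algebraMap (BaseField F n) (BaseClosure F n)).injective
  rw [charpoly_psiOp_map]
  have h := congrArg (eval₂RingHom (mapRingHom (resEmb n f))
    (C (algebraMap _ (BaseClosure F n) (evalProd n f.1)))) (map_localPoly φ f)
  rw [twistPoly, map_twistDet] at h
  simp only [coe_eval₂RingHom, eval₂_C, eval₂_X, coe_mapRingHom, map_C, map_X] at h
  rw [← h, eval₂_map, ← coe_mapRingHom, eval_map, hom_eval₂, coe_mapRingHom, map_C]
  congr 1
  rw [mapRingHom_comp, mapRingHom_comp]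
  congr 1
  exact RingHom.ext fun a => by
    rw [RingHom.comp_apply, resEmb, AdjoinRoot.algebraMap_eq, AdjoinRoot.lift_of,
      RingHom.comp_apply, ← IsScalarTower.algebraMap_apply]

theorem fittingGen_psiModule : fittingGen (BaseField F n) (PsiModule n φ f) =
    ((localPoly φ f).map (mapRingHom (algebraMap F (BaseField F n)))).eval
      (C (evalProd n f.1)) := by
  rw [← charpoly_psiOp, fittingGen,
    ← LinearEquiv.charpoly_conj (Module.AEval'.of (psiOp n φ f)) (psiOp n φ f)]
  congr 1
  refine LinearMap.ext fun w => ?_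
  obtain ⟨w, rfl⟩ := (Module.AEval'.of (psiOp n φ f)).surjective w
  rw [LinearEquiv.conj_apply_apply, LinearEquiv.symm_apply_apply]
  exact Module.AEval'.X_smul_of _ w

end PsiCharpoly

/-! ### Euler products in nonarchimedean rings -/

section EulerProduct

open Filter Topology

variable {ι R : Type*}

theorem prod_add_single [CommMonoid R] {g : ι → ℕ → R} (hg : ∀ i, g i 0 = 1) {s : Finset ι} {i : ι}
    (hi : i ∉ s) (j : ℕ) {m : ι →₀ ℕ} (hm : m.support ⊆ s) :
    (Finsupp.single i j + m).prod g = g i j * m.prod g := by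
  classical
  rw [Finsupp.prod_add_index_of_disjoint, Finsupp.prod_single_index (hg i)]
  exact Finset.disjoint_of_subset_left Finsupp.support_single_subset
    (Finset.disjoint_singleton_left.mpr fun h => hi (hm h))

/-- Adding a multiple of `i` to a multiset of elements of `s` not containing `i`. -/
def insertEquiv [DecidableEq ι] {s : Finset ι} {i : ι} (hi : i ∉ s) :
    ℕ × {m : ι →₀ ℕ // m.support ⊆ s} ≃ {m : ι →₀ ℕ // m.support ⊆ insert i s} where
  toFun p := ⟨Finsupp.single i p.1 + p.2.1, Finsupp.support_add.trans
    (Finset.union_subset (Finsupp.support_single_subset.trans (by simp))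
      (p.2.2.trans (Finset.subset_insert i s)))⟩
  invFun m := ⟨m.1 i, m.1.erase i, by
    rw [Finsupp.support_erase, ← Finset.subset_insert_iff]
    exact m.2⟩
  left_inv := by
    rintro ⟨j, m, hm⟩
    have h : m i = 0 := Finsupp.notMem_support_iff.mp fun h => hi (hm h)
    refine Prod.ext (by simp [h]) (Subtype.ext ?_)
    simp [Finsupp.erase_add, Finsupp.erase_single, Finsupp.erase_of_notMem_support
      (Finsupp.notMem_support_iff.mpr h)]
  right_inv m := Subtype.ext (Finsupp.single_add_erase i m.1)

variable [CommRing R] [UniformSpace R] [IsUniformAddGroup R] [NonarchimedeanRing R]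

/-- In a nonarchimedean ring the product of two summable families is summable, so a finite product
of sums may be multiplied out. -/
theorem hasSum_prod_of_support_subset {g : ι → ℕ → R} (hg : ∀ i, g i 0 = 1) {a : ι → R}
    (ha : ∀ i, HasSum (g i) (a i)) (s : Finset ι) :
    HasSum (fun m : {m : ι →₀ ℕ // m.support ⊆ s} => m.1.prod g) (∏ i ∈ s, a i) := by
  classical
  induction s using Finset.induction_on with
  | empty =>
    have h : ∀ m : {m : ι →₀ ℕ // m.support ⊆ ∅}, m = ⟨0, by simp⟩ := fun m =>
      Subtype.ext (Finsupp.support_eq_empty.mp (Finset.subset_empty.mp m.2))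
    rw [Finset.prod_empty]
    exact hasSum_single (⟨0, by simp⟩ : {m : ι →₀ ℕ // m.support ⊆ ∅})
      fun m hm => (hm (h m)).elim
  | insert i s hi ih =>
    rw [Finset.prod_insert hi, ← (insertEquiv hi).hasSum_iff]
    refine ((ha i).mul_of_nonarchimedean ih).congr_fun ?_
    exact fun p => prod_add_single hg hi p.1 p.2.2

/-- If `b e = 1` for formal power series and both converge at `x`, the product of the values at `x`
is `1`. -/
theorem tsum_mul_tsum_eq_one [T2Space R] {b e : ℕ → R} (hb : Summable b) (he : Summable e)
    (h : ∀ m, ∑ p ∈ Finset.HasAntidiagonal.antidiagonal m, b p.1 * e p.2 = if m = 0 then 1 else 0) :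
    (∑' i, b i) * ∑' i, e i = 1 := by
  rw [hb.tsum_mul_tsum_eq_tsum_sum_antidiagonal he (hb.mul_of_nonarchimedean he)]
  simp_rw [h]
  exact tsum_ite_eq 0 1

/-- An Euler product whose expansion is summable converges to the sum of its expansion. -/
theorem hasProd_of_hasSum_finsupp_prod {g : ι → ℕ → R} (hg : ∀ i, g i 0 = 1) {a : ι → R}
    (ha : ∀ i, HasSum (g i) (a i)) {S : R} (hS : HasSum (fun m : ι →₀ ℕ => m.prod g) S) :
    HasProd a S := by
  classical
  rw [HasProd, SummationFilter.unconditional_filter]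
  rw [HasSum, SummationFilter.unconditional_filter] at hS
  -- For a closed neighbourhood `U` of `S`, choose a finite `T` beyond which partial sums lie in
  -- `U`. If `s` contains all supports from `T`, the partial product over `s` is a limit of such
  -- partial sums, hence in `U`.
  refine (closed_nhds_basis S).tendsto_right_iff.mpr fun U hU => ?_
  obtain ⟨T, hT⟩ := eventually_atTop.mp (hS.eventually_mem hU.1)
  refine eventually_atTop.mpr ⟨T.biUnion Finsupp.support, fun s hs => ?_⟩
  have h := hasSum_prod_of_support_subset hg ha s
  rw [HasSum, SummationFilter.unconditional_filter] at h
  refine hU.2.mem_of_tendsto h (eventually_atTop.mpr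
    ⟨T.subtype fun m => m.support ⊆ s, fun T' hT' => ?_⟩)
  have h' := hT (T'.map (Function.Embedding.subtype _)) fun m hm =>
    Finset.mem_map.mpr ⟨⟨m, (Finset.subset_biUnion_of_mem _ hm).trans hs⟩,
      hT' (Finset.mem_subtype.mpr hm), rfl⟩
  simpa using h'

end EulerProduct

/-! ### The valuation on Laurent series -/

section Laurent

open Filter Topology WithZero

variable {k : Type*} [Field k]

instance : NonarchimedeanRing (LaurentSeries k) :=
  (Valued.v (R := LaurentSeries k)).subgroups_basis.nonarchimedean

theorem tendsto_zero_of_valuation_le {α : Type*} {l : Filter α} {g : α → LaurentSeries k}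
    (h : ∀ N : ℕ, ∀ᶠ a in l, Valued.v (g a) ≤ exp (-(N : ℤ))) : Tendsto g l (𝓝 0) := by
  refine (Valued.hasBasis_nhds_zero (LaurentSeries k) ℤᵐ⁰).tendsto_right_iff.mpr fun γ _ => ?_
  have hγ : MonoidWithZeroHom.ValueGroup₀.embedding γ.1 ≠ (0 : ℤᵐ⁰) := by
    rw [Ne, map_eq_zero]
    exact γ.ne_zero
  obtain ⟨c, hc⟩ : ∃ c : ℤ, MonoidWithZeroHom.ValueGroup₀.embedding γ.1 = exp c :=
    ⟨_, (exp_log hγ).symm⟩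
  -- With `N ≥ 1 - c` one has `-N < c`, giving the strict inequality.
  filter_upwards [h (1 - c).toNat] with a ha
  rw [Valued.v.restrict_lt_iff_lt_embedding, hc]
  refine ha.trans_lt (exp_lt_exp.mpr ?_)
  lia

theorem valuation_toLaurent_C_le (c : k) : Valued.v (toLaurent k (C c)) ≤ 1 := by
  rw [← exp_zero, ← neg_zero, LaurentSeries.valuation_le_iff_coeff_lt_eq_zero]
  intro m hm
  rw [toLaurent, aeval_C, LaurentSeries.algebraMap_apply, HahnSeries.C_apply,
    HahnSeries.coeff_single_of_ne hm.ne]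

theorem valuation_toLaurent_C {c : k} (hc : c ≠ 0) : Valued.v (toLaurent k (C c)) = 1 := by
  refine (valuation_toLaurent_C_le c).antisymm (le_of_mul_le_mul_right ?_ (?_ : 0 <
    Valued.v (toLaurent k (C c⁻¹))))
  · rw [← map_mul, ← map_mul, ← C_mul, mul_inv_cancel₀ hc, C_1, map_one, map_one, one_mul]
    exact valuation_toLaurent_C_le c⁻¹
  · refine zero_lt_iff.mpr fun h => one_ne_zero (α := ℤᵐ⁰) ?_
    rw [← map_one (Valued.v (R := LaurentSeries k)), ← map_one (toLaurent k), ← C_1, ← mul_inv_cancel₀ hc, C_mul, map_mul,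
      map_mul, h, mul_zero]

theorem valuation_toLaurent_X_pow (i : ℕ) : Valued.v (toLaurent k (X ^ i)) = exp (i : ℤ) := by
  rw [map_pow, map_pow, toLaurent, aeval_X, LaurentSeries.valuation_single_zpow, neg_neg,
    ← exp_nsmul, nsmul_one]

theorem valuation_toLaurent_le (p : k[X]) :
    Valued.v (toLaurent k p) ≤ exp (p.natDegree : ℤ) := by
  nth_rw 1 [p.as_sum_range_C_mul_X_pow]
  rw [map_sum]
  refine Valuation.map_sum_le _ fun i hi => ?_
  rw [map_mul, map_mul, valuation_toLaurent_X_pow]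
  refine (mul_le_of_le_one_left' (valuation_toLaurent_C_le _)).trans (exp_le_exp.mpr ?_)
  exact_mod_cast Nat.lt_succ_iff.mp (Finset.mem_range.mp hi)

theorem valuation_toLaurent {p : k[X]} (hp : p ≠ 0) :
    Valued.v (toLaurent k p) = exp (p.natDegree : ℤ) := by
  have hlead : Valued.v (toLaurent k (C p.leadingCoeff * X ^ p.natDegree)) =
      exp (p.natDegree : ℤ) := by
    rw [map_mul, map_mul, valuation_toLaurent_X_pow,
      valuation_toLaurent_C (leadingCoeff_ne_zero.mpr hp), one_mul]
  nth_rw 1 [← p.eraseLead_add_C_mul_X_pow]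
  rw [map_add, Valuation.map_add_eq_of_lt_right, hlead]
  rw [hlead]
  rcases p.eraseLead_natDegree_lt_or_eraseLead_eq_zero with h | h
  · exact (valuation_toLaurent_le _).trans_lt (exp_lt_exp.mpr (by exact_mod_cast h))
  · rw [h, map_zero, map_zero]
    exact exp_pos

theorem toLaurent_injective : Function.Injective (toLaurent k) :=
  (injective_iff_map_eq_zero _).mpr fun p hp => by
    by_contra h
    have := valuation_toLaurent h
    rw [hp, map_zero] at this
    exact exp_ne_zero this.symm

end Laurent

/-! ### The expansion of the Euler product -/

section Factorization

variable {F : Type*} [Field F]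

/-- The monic polynomial with a given factorization. -/
def factorProd (m : MonicIrred F →₀ ℕ) : MonicPoly F :=
  ⟨m.prod fun f i => f.1 ^ i, monic_prod_of_monic _ _ fun f _ => f.2.1.pow _⟩

theorem multiplicity_factorProd (m : MonicIrred F →₀ ℕ) (f : MonicIrred F) :
    multiplicity f.1 (factorProd m).1 = m f := by
  classical
  have h : (factorProd m).1 = f.1 ^ m f * (m.erase f).prod fun g i => g.1 ^ i :=
    (Finsupp.mul_prod_erase' m f _ fun _ => pow_zero _).symm
  have hf : ¬ f.1 ∣ (m.erase f).prod fun g i => g.1 ^ i := by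
    intro hd
    obtain ⟨g, hg, hd⟩ := (Prime.dvd_finsetProd_iff f.2.2.prime _).mp hd
    rw [Finsupp.support_erase] at hg
    refine Finset.ne_of_mem_erase hg (Subtype.ext ?_)
    exact (eq_of_monic_of_associated f.2.1 g.2.1
      ((f.2.2.dvd_irreducible_iff_associated g.2.2).mp (f.2.2.prime.dvd_of_dvd_pow hd))).symm
  refine multiplicity_eq_of_dvd_of_not_dvd (h ▸ dvd_mul_right _ _) fun hd => hf ?_
  rw [h, pow_succ] at hd
  exact (mul_dvd_mul_iff_left (pow_ne_zero _ f.2.1.ne_zero)).mp hd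

theorem factorProd_surjective : Function.Surjective (factorProd (F := F)) := by
  rintro ⟨a, ha⟩
  induction hd : a.natDegree using Nat.strong_induction_on generalizing a with
  | _ d ih =>
    rcases Nat.eq_zero_or_pos d with rfl | hpos
    · exact ⟨0, Subtype.ext (by
        simpa [factorProd] using (eq_one_of_monic_natDegree_zero ha hd).symm)⟩
    · have hu : ¬ IsUnit a := fun h => by
        rw [natDegree_eq_zero_of_isUnit h] at hd
        exact hpos.ne hd
      obtain ⟨f, hf, hfi, b, rfl⟩ := exists_monic_irreducible_factor a hu
      have hb : b.Monic := hf.of_mul_monic_left ha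
      have hlt := hfi.natDegree_pos
      rw [hf.natDegree_mul hb] at hd
      obtain ⟨m, hm⟩ := ih b.natDegree (by lia) b hb rfl
      refine ⟨Finsupp.single ⟨f, hf, hfi⟩ 1 + m, Subtype.ext ?_⟩
      have hm' : m.prod (fun f i => f.1 ^ i) = b := congrArg Subtype.val hm
      classical
      change Finsupp.prod _ (fun (g : MonicIrred F) i => g.1 ^ i) = _
      rw [Finsupp.prod_add_index' (h := fun (g : MonicIrred F) i => g.1 ^ i)
        (fun _ => pow_zero _) fun _ _ _ => pow_add _ _ _, hm',
        Finsupp.prod_single_index (h := fun (g : MonicIrred F) i => g.1 ^ i) (pow_zero _), pow_one]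

/-- Unique factorization of monic polynomials. -/
def factorEquiv : (MonicIrred F →₀ ℕ) ≃ MonicPoly F :=
  Equiv.ofBijective factorProd ⟨fun m m' h => Finsupp.ext fun f => by
    rw [← multiplicity_factorProd, h, multiplicity_factorProd], factorProd_surjective⟩

theorem finite_natDegree_lt [Finite F] (D : ℕ) : {a : MonicPoly F | a.1.natDegree < D}.Finite := by
  have : Finite (degreeLT F D) := Module.finite_of_finite F
  refine Set.Finite.of_finite_image (f := Subtype.val)
    ((Set.toFinite (degreeLT F D : Set F[X])).subset ?_) Subtype.val_injective.injOn
  rintro _ ⟨a, ha, rfl⟩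
  rw [SetLike.mem_coe, mem_degreeLT]
  exact (natDegree_lt_iff_degree_lt a.2.ne_zero).mp ha

variable (n : ℕ)

theorem evalProd_one : evalProd n (1 : F[X]) = 1 := by simp [evalProd]

theorem evalProd_mul {a b : F[X]} (ha : a ≠ 0) (hb : b ≠ 0) :
    evalProd n (a * b) = evalProd n a * evalProd n b := by
  simp only [evalProd, map_mul, Finset.prod_mul_distrib, natDegree_mul ha hb, pow_add]
  ring

theorem evalProd_pow {a : F[X]} (ha : a ≠ 0) (i : ℕ) : evalProd n (a ^ i) = evalProd n a ^ i := by
  induction i with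
  | zero => rw [pow_zero, pow_zero, evalProd_one]
  | succ i ih => rw [pow_succ, pow_succ, evalProd_mul n (pow_ne_zero i ha) ha, ih]

theorem evalProd_factorProd (m : MonicIrred F →₀ ℕ) :
    evalProd n (factorProd m).1 = m.prod fun f i => evalProd n f.1 ^ i := by
  classical
  simp only [factorProd, Finsupp.prod]
  induction m.support using Finset.induction_on with
  | empty => simp [evalProd_one]
  | insert f s hf ih =>
    rw [Finset.prod_insert hf, Finset.prod_insert hf, evalProd_mul n
      (pow_ne_zero _ f.2.1.ne_zero)
      (Finset.prod_ne_zero_iff.mpr fun g _ => pow_ne_zero _ g.2.1.ne_zero), ih,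
      evalProd_pow n f.2.1.ne_zero]

theorem toLaurent_baseChange_ne_zero (f : MonicIrred F) :
    toLaurent _ (baseChange n f.1) ≠ 0 :=
  (map_ne_zero_iff _ toLaurent_injective).mpr (f.2.1.map _).ne_zero

end Factorization

/-! ### Degree bounds, convergence and expansion of the Euler product -/

section Expansion

theorem mul_pow_sub_one_mul_div {K : Type*} [Field K] {x : K} (hx : x ≠ 0) (a c : K) {i : ℕ}
    (hi : 0 < i) : a * x ^ (i - 1) * (c ^ i / x ^ i) = a * c ^ i / x := by
  rw [mul_div_assoc', div_eq_div_iff (pow_ne_zero i hx) hx, ← pow_sub_one_mul hi.ne' x]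
  ring

variable {F : Type*} [Field F] [Fintype F] (n : ℕ) (φ : DrinfeldModule F)

theorem mu_factorProd (m : MonicIrred F →₀ ℕ) :
    mu φ (factorProd m) = m.prod fun f i => PowerSeries.coeff i (eulerSeries φ f) := by
  rw [mu]
  simp_rw [multiplicity_factorProd]
  refine finprod_eq_prod_of_mulSupport_subset _ fun f hf => ?_
  rw [Finset.mem_coe, Finsupp.mem_support_iff]
  intro h
  refine hf ?_
  beta_reduce
  rw [h, eulerSeries, PowerSeries.coeff_zero_eq_constantCoeff, PowerSeries.constantCoeff_invOfUnit]
  simp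

/-- For `i > 0` the weight bound gives `r deg Q_i ≤ r d - d i`; adding `r d (i - 1)` for `f ^ (i -
1)` gives `(r - 1) d i`. -/
theorem rank_mul_natDegree_coeff_eulerPoly_le (f : MonicIrred F) (i : ℕ) :
    φ.rank * ((eulerPoly φ f).coeff i).natDegree ≤ (φ.rank - 1) * (f.1.natDegree * i) := by
  rcases Nat.eq_zero_or_pos i with rfl | hi
  · rw [coeff_eulerPoly_zero, natDegree_one, mul_zero, mul_zero, mul_zero]
  rw [coeff_eulerPoly_of_pos φ f hi]
  by_cases h : (localPoly φ f).coeff i = 0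
  · rw [h, zero_mul, natDegree_zero, mul_zero]
    exact zero_le
  have hw := weight_coeff_localPoly_le φ f h
  rw [natDegree_mul h (pow_ne_zero _ f.2.1.ne_zero), natDegree_pow]
  obtain ⟨j, rfl⟩ := Nat.exists_eq_add_of_le' hi
  obtain ⟨s, hs⟩ := Nat.exists_eq_add_of_le' φ.rank_pos
  rw [hs] at hw ⊢
  simp only [Nat.add_sub_cancel]
  nlinarith

theorem rank_mul_natDegree_coeff_eulerSeries_le (f : MonicIrred F) (i : ℕ) :
    φ.rank * (PowerSeries.coeff i (eulerSeries φ f)).natDegree ≤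
      (φ.rank - 1) * (f.1.natDegree * i) := by
  induction i using Nat.strong_induction_on with
  | _ i ih =>
    rw [mul_comm, ← Nat.le_div_iff_mul_le φ.rank_pos, eulerSeries, PowerSeries.coeff_invOfUnit]
    split_ifs with hi
    · simp
    rw [inv_one, Units.val_one, neg_one_mul, natDegree_neg]
    refine natDegree_sum_le_of_forall_le _ _ fun p hp => ?_
    split_ifs with hlt
    · rw [Nat.le_div_iff_mul_le φ.rank_pos, Polynomial.coeff_coe, mul_comm]
      have h1 := rank_mul_natDegree_coeff_eulerPoly_le φ f p.1
      have h2 := ih p.2 hlt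
      rw [eulerSeries] at h2
      rw [← Finset.HasAntidiagonal.mem_antidiagonal.mp hp]
      refine (Nat.mul_le_mul_left _ natDegree_mul_le).trans ?_
      rw [mul_add, mul_add, mul_add]
      exact add_le_add h1 h2
    · simp

theorem rank_mul_natDegree_mu_le (a : MonicPoly F) :
    φ.rank * (mu φ a).natDegree ≤ (φ.rank - 1) * a.1.natDegree := by
  obtain ⟨m, rfl⟩ := factorProd_surjective a
  rw [mu_factorProd]
  refine (Nat.mul_le_mul_left _ (natDegree_prod_le _ _)).trans ?_
  simp only [factorProd, Finsupp.prod]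
  rw [natDegree_prod_of_monic _ _ fun f _ => f.2.1.pow _, Finset.mul_sum, Finset.mul_sum]
  refine Finset.sum_le_sum fun f _ => ?_
  rw [natDegree_pow, mul_comm (m f)]
  exact rank_mul_natDegree_coeff_eulerSeries_le φ f (m f)

open WithZero in
-- The values at `z_j` and `t` are constants of `k((θ⁻¹))`, hence units of valuation `1`; only `deg
-- μ(a) - deg a ≤ -deg a / r` counts.
theorem valuation_seriesTerm_le {N : ℕ} {a : MonicPoly F} (ha : φ.rank * N ≤ a.1.natDegree) :
    Valued.v (seriesTerm n φ a) ≤ exp (-(N : ℤ)) := by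
  rw [seriesTerm, ← evalProd, map_div₀, valuation_toLaurent (a.2.map _).ne_zero, map_mul, map_mul,
    valuation_toLaurent_C (evalProd_ne_zero n a.2.ne_zero), mul_one]
  refine (div_le_div_of_nonneg_right (valuation_toLaurent_le _) zero_le).trans ?_
  rw [← exp_sub, exp_le_exp, natDegree_map, natDegree_map]
  have h := rank_mul_natDegree_mu_le φ a
  obtain ⟨s, hs⟩ := Nat.exists_eq_add_of_le' φ.rank_pos
  rw [hs] at h ha
  rw [Nat.add_sub_cancel] at h
  suffices (mu φ a).natDegree + N ≤ a.1.natDegree by lia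
  refine Nat.le_of_mul_le_mul_left (?_ : (s + 1) * _ ≤ (s + 1) * _) s.succ_pos
  nlinarith

theorem summable_seriesTerm : Summable (seriesTerm n φ) := by
  refine NonarchimedeanAddGroup.summable_of_tendsto_cofinite_zero
    (tendsto_zero_of_valuation_le fun N => ?_)
  refine (finite_natDegree_lt (F := F) (φ.rank * N)).subset fun a ha => ?_
  by_contra h
  exact ha (valuation_seriesTerm_le n φ (not_lt.mp h))

/-- The ratio `t ^ d f(z₁) ⋯ f(z_n) / f`, where `d = deg f`. -/
def evalRatio (f : MonicIrred F) : LaurentSeries (BaseField F n) :=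
  toLaurent _ (C (evalProd n f.1)) / toLaurent _ (baseChange n f.1)

/-- The term `μ(f ^ i) x ^ i` of the Euler factor at `f`, where `x = t ^ d f(z₁) ⋯ f(z_n) / f`. -/
def localTerm (f : MonicIrred F) (i : ℕ) : LaurentSeries (BaseField F n) :=
  toLaurent _ (baseChange n (PowerSeries.coeff i (eulerSeries φ f))) * evalRatio n f ^ i

theorem localTerm_zero (f : MonicIrred F) : localTerm n φ f 0 = 1 := by
  rw [localTerm, eulerSeries, PowerSeries.coeff_zero_eq_constantCoeff,
    PowerSeries.constantCoeff_invOfUnit]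
  simp

theorem seriesTerm_factorProd (m : MonicIrred F →₀ ℕ) :
    seriesTerm n φ (factorProd m) = m.prod (localTerm n φ) := by
  change toLaurent _ (baseChange n (mu φ (factorProd m)) * C (evalProd n (factorProd m).1)) /
    toLaurent _ (baseChange n (factorProd m).1) = _
  rw [mu_factorProd, evalProd_factorProd, factorProd, baseChange, baseChange]
  simp only [Finsupp.prod, Polynomial.map_prod, map_prod, map_mul]
  rw [← Finset.prod_mul_distrib, ← Finset.prod_div_distrib]
  refine Finset.prod_congr rfl fun f _ => ?_
  rw [localTerm, evalRatio, div_pow, mul_div_assoc, C_pow, map_pow, Polynomial.map_pow, map_pow]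

/-- Because `D_f(x) = Q_f(θ, f x) / f`, the value at `x = t ^ d f(z₁) ⋯ f(z_n) / f` is the quotient
of the two Fitting generators. -/
theorem hasSum_eulerPoly (f : MonicIrred F) :
    HasSum (fun i => toLaurent _ (baseChange n ((eulerPoly φ f).coeff i)) * evalRatio n f ^ i)
      (taelmanFactor n φ f)⁻¹ := by
  have h0 := toLaurent_baseChange_ne_zero n f
  have hterm : ∀ i, toLaurent _ (baseChange n ((eulerPoly φ f).coeff i)) * evalRatio n f ^ i =
      toLaurent _ (baseChange n ((localPoly φ f).coeff i) * C (evalProd n f.1) ^ i) /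
        toLaurent _ (baseChange n f.1) := by
    intro i
    rw [evalRatio, div_pow, map_mul, map_pow]
    rcases Nat.eq_zero_or_pos i with rfl | hi
    · rw [coeff_eulerPoly_zero, localPoly_coeff_zero]
      simp [h0]
    · rw [coeff_eulerPoly_of_pos φ f hi, baseChange, Polynomial.map_mul, Polynomial.map_pow,
        map_mul, map_pow]
      exact mul_pow_sub_one_mul_div h0 _ _ hi
  rw [taelmanFactor, inv_div, fittingGen_psiModule, fittingGen_primeQuot, eval_map,
    eval₂_eq_sum_range, map_sum, Finset.sum_div]
  simp_rw [hterm]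
  refine hasSum_sum_of_ne_finset_zero fun i hi => ?_
  rw [coeff_eq_zero_of_natDegree_lt (by simpa using hi)]
  simp

/-- The local terms are the terms of the series at the powers of `f`, so they are summable; their
sum is then determined by `D_f D_f⁻¹ = 1`. -/
theorem hasSum_localTerm (f : MonicIrred F) : HasSum (localTerm n φ f) (taelmanFactor n φ f) := by
  have hs : Summable (localTerm n φ f) := by
    refine ((summable_seriesTerm n φ).comp_injective (i := fun i => factorProd (Finsupp.single f i))
      (factorEquiv.injective.comp (Finsupp.single_injective f))).congr fun i => ?_
    rw [Function.comp_apply, seriesTerm_factorProd,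
      Finsupp.prod_single_index (localTerm_zero n φ f)]
  have hB := hasSum_eulerPoly n φ f
  have h := tsum_mul_tsum_eq_one hB.summable hs fun m => by
    have hc := congrArg (PowerSeries.coeff m) (PowerSeries.mul_invOfUnit
      (eulerPoly φ f : PowerSeries F[X]) 1 (by
        rw [← PowerSeries.coeff_zero_eq_constantCoeff, Polynomial.coeff_coe,
          coeff_eulerPoly_zero, Units.val_one]))
    rw [PowerSeries.coeff_mul, PowerSeries.coeff_one] at hc
    have hc' := congrArg (fun a => toLaurent _ (baseChange n a) * evalRatio n f ^ m) hc
    simp only [baseChange, Polynomial.map_sum, map_sum, Finset.sum_mul] at hc'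
    refine Eq.trans (Finset.sum_congr rfl fun p hp => ?_) (hc'.trans ?_)
    · rw [localTerm, eulerSeries, ← Finset.HasAntidiagonal.mem_antidiagonal.mp hp, Polynomial.map_mul, map_mul,
        Polynomial.coeff_coe, pow_add]
      ring
    · split_ifs with hm
      · simp [hm]
      · simp
  rw [hB.tsum_eq] at h
  rw [← inv_inv (taelmanFactor n φ f), ← eq_inv_of_mul_eq_one_right h]
  exact hs.hasSum

theorem hasProd_taelmanFactor : HasProd (taelmanFactor n φ) (∑' a, seriesTerm n φ a) := by
  refine hasProd_of_hasSum_finsupp_prod (localTerm_zero n φ) (hasSum_localTerm n φ) ?_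
  refine ((factorEquiv.hasSum_iff.mpr (summable_seriesTerm n φ).hasSum)).congr_fun fun m => ?_
  exact (seriesTerm_factorProd n φ m).symm

end Expansion

end TaelmanL

end

theorem mainTheorem7 {F : Type*} [Field F] [Fintype F] (n : ℕ) (φ : TaelmanL.DrinfeldModule F) :
    Multipliable (TaelmanL.taelmanFactor n φ) ∧
      HasSum (TaelmanL.seriesTerm n φ) (TaelmanL.taelmanLValue n φ) := by
  have h := TaelmanL.hasProd_taelmanFactor n φ
  refine ⟨h.multipliable, ?_⟩
  -- The infinite product has its genuine value here, not a default, since `h` is a convergence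
  -- statement.
  rw [TaelmanL.taelmanLValue, h.tprod_eq]
  exact (TaelmanL.summable_seriesTerm n φ).hasSum
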